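/- Let $n,s\ge 1$ and let $M$ be a smooth manifold of dimension $2n+s$ with a Riemannian metric $g$, Levi-Civita connection $\nabla$ and curvature tensor $R_{X,Y}=[\nabla_X,\nabla_Y]-\nabla_{[X,Y]}$. A \emph{weak metric $f$-structure} on $M$ is a tuple $(f,Q,\vec\xi,\vec\eta,g)$, where $f$ is a skew-symmetric $(1,1)$-tensor of rank $2n$, $Q$ is a self-adjoint nonsingular $(1,1)$-tensor, $\xi_1,\dots,\xi_s$ are orthonormal vector fields and $\eta^1,\dots,\eta^s$ are 1-forms (all smooth), such that $$f^2=-Q+\sum_{i=1}^s\eta^i\otimes\xi_i,\qquad \eta^i(\xi_j)=\delta^i_j,\qquad Q\xi_i=\xi_i,\qquad g(fX,fY)=g(X,QY)-\sum_{i=1}^s\eta^i(X)\,\eta^i(Y).$$ It is a \emph{weak nearly $\mathcal C$-structure}, and $M$ a \emph{weak nearly $\mathcal C$-manifold}, if $(\nabla_Xf)Y+(\nabla_Yf)X=0$ for all vector fields $X,Y$. Put $\mathcal D=\bigcap_{i=1}^s\ker\eta^i$ (the contact distribution) and $\widetilde Q=Q-\mathrm{id}$. Let $(M,f,Q,\vec\xi,\vec\eta,g)$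 be a weak nearly $\mathcal C$-manifold. Then for all vector fields $X,Y,Z,V$ $$g(R_{fX,Y}Z,V)+g(R_{X,fY}Z,V)+g(R_{X,Y}fZ,V)+g(R_{X,Y}Z,fV)=0.$$ Assume moreover that $$(\nabla_XQ)Y=0\quad(X\in\mathfrak X_M,\ Y\in\mathcal D)\qquad\text{and}\qquad R_{\widetilde QX,Y}Z\in\mathcal D\quad(X,Y,Z\in\mathcal D).$$ Then (1) $g(R_{\xi_j,Z}fX,fY)=0$ for all $1\le j\le s$, all vector fields $X,Y$ and all $Z\in\mathcal D$; and $\mathcal D$ is curvature invariant, i.e. $R_{X,Y}Z\in\mathcal D$ for all $X,Y,Z\in\mathcal D$. (2) If in addition $[\xi_i,\xi_j]=0$ for all $1\le i,j\le s$ (which is automatic for $s=1$), then $R_{\xi_j,\xi_k}=0$ for all $1\le j,k\le s$, and $g(R_{\xi_j,Z}fX,fY)=0$ for all $1\le j\le s$ and all vector fields $X,Y,Z$. -/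

import Mathlib

open Bundle VectorField Module
open scoped Manifold ContDiff

noncomputable section

namespace WeakNearlyC

variable {E : Type*} [NormedAddCommGroup E] [NormedSpace ℝ E]
  {H : Type*} [TopologicalSpace H] {I : ModelWithCorners ℝ E H}
  {M : Type*} [TopologicalSpace M] [ChartedSpace H M] [IsManifold I ∞ M]

/-! ### Riemannian metrics and the Levi-Civita connection -/

/-- `g(X, Y)` is differentiable wherever the vector fields `X` and `Y` are. -/
lemma mdifferentiableAt_metric
    (g : ContMDiffRiemannianMetric I ∞ E (fun x : M ↦ TangentSpace I x))
    {X Y : Π x : M, TangentSpace I x} {x : M}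
    (hX : MDiffAt (T% X) x) (hY : MDiffAt (T% Y) x) :
    MDiffAt (fun y ↦ g.inner y (X y) (Y y)) x := by
  have h := (g.contMDiff.mdifferentiable (by simp)) x
  have : MDifferentiableAt I (I.prod 𝓘(ℝ, ℝ))
      (fun m ↦ TotalSpace.mk' ℝ (E := Bundle.Trivial M ℝ) m (g.inner m (X m) (Y m))) x :=
    MDifferentiableAt.clm_bundle_apply₂ (F₁ := E) (F₂ := E) h hX hY
  rw [mdifferentiableAt_totalSpace] at this
  exact this.2

/-- The right-hand side of the Koszul formula, i.e. the value of `g(∇_X Y, Z)` at `x`. -/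
def koszul (g : ContMDiffRiemannianMetric I ∞ E (fun x : M ↦ TangentSpace I x))
    (X Y Z : Π x : M, TangentSpace I x) (x : M) : ℝ :=
  (d% (fun y ↦ g.inner y (Y y) (Z y)) x (X x)
    + d% (fun y ↦ g.inner y (X y) (Z y)) x (Y x)
    - d% (fun y ↦ g.inner y (X y) (Y y)) x (Z x)
    + g.inner x (mlieBracket I X Y x) (Z x)
    - g.inner x (mlieBracket I X Z x) (Y x)
    - g.inner x (mlieBracket I Y Z x) (X x)) / 2

variable [FiniteDimensional ℝ E]
  (g : ContMDiffRiemannianMetric I ∞ E (fun x : M ↦ TangentSpace I x))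

lemma koszul_tensorial_left {Y Z : Π x : M, TangentSpace I x} {x : M}
    (hY : MDiffAt (T% Y) x) (hZ : MDiffAt (T% Z) x) :
    TensorialAt I E (fun X ↦ koszul g X Y Z x) x where
  smul {f X} hf hX := by
    have h1 : (fun y ↦ g.inner y ((f • X) y) (Z y)) = fun y ↦ f y * g.inner y (X y) (Z y) := by
      ext y; simp
    have h2 : (fun y ↦ g.inner y ((f • X) y) (Y y)) = fun y ↦ f y * g.inner y (X y) (Y y) := by
      ext y; simp
    simp only [koszul, h1, h2]
    rw [mvfderiv_fun_mul hf (mdifferentiableAt_metric g hX hZ),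
      mvfderiv_fun_mul hf (mdifferentiableAt_metric g hX hY),
      mlieBracket_smul_left hf hX, mlieBracket_smul_left hf hX]
    simp
    ring
  add {X X'} hX hX' := by
    have h1 : (fun y ↦ g.inner y ((X + X') y) (Z y))
        = fun y ↦ g.inner y (X y) (Z y) + g.inner y (X' y) (Z y) := by
      ext y; simp
    have h2 : (fun y ↦ g.inner y ((X + X') y) (Y y))
        = fun y ↦ g.inner y (X y) (Y y) + g.inner y (X' y) (Y y) := by
      ext y; simp
    simp only [koszul, h1, h2]
    rw [mvfderiv_fun_add (mdifferentiableAt_metric g hX hZ) (mdifferentiableAt_metric g hX' hZ),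
      mvfderiv_fun_add (mdifferentiableAt_metric g hX hY) (mdifferentiableAt_metric g hX' hY),
      mlieBracket_add_left hX hX', mlieBracket_add_left hX hX']
    simp
    ring

lemma koszul_tensorial_right {X Y : Π x : M, TangentSpace I x} {x : M}
    (hX : MDiffAt (T% X) x) (hY : MDiffAt (T% Y) x) :
    TensorialAt I E (fun Z ↦ koszul g X Y Z x) x where
  smul {f Z} hf hZ := by
    have h1 : (fun y ↦ g.inner y (X y) ((f • Z) y)) = fun y ↦ f y * g.inner y (X y) (Z y) := by
      ext y; simp
    have h2 : (fun y ↦ g.inner y (Y y) ((f • Z) y)) = fun y ↦ f y * g.inner y (Y y) (Z y) := by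
      ext y; simp
    simp only [koszul, h1, h2]
    rw [mvfderiv_fun_mul hf (mdifferentiableAt_metric g hX hZ),
      mvfderiv_fun_mul hf (mdifferentiableAt_metric g hY hZ),
      mlieBracket_smul_right hf hZ, mlieBracket_smul_right hf hZ]
    simp
    rw [g.symm x (Z x) (Y x), g.symm x (Z x) (X x)]
    ring
  add {Z Z'} hZ hZ' := by
    have h1 : (fun y ↦ g.inner y (X y) ((Z + Z') y))
        = fun y ↦ g.inner y (X y) (Z y) + g.inner y (X y) (Z' y) := by
      ext y; simp
    have h2 : (fun y ↦ g.inner y (Y y) ((Z + Z') y))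
        = fun y ↦ g.inner y (Y y) (Z y) + g.inner y (Y y) (Z' y) := by
      ext y; simp
    simp only [koszul, h1, h2]
    rw [mvfderiv_fun_add (mdifferentiableAt_metric g hX hZ) (mdifferentiableAt_metric g hX hZ'),
      mvfderiv_fun_add (mdifferentiableAt_metric g hY hZ) (mdifferentiableAt_metric g hY hZ'),
      mlieBracket_add_right hZ hZ', mlieBracket_add_right hZ hZ']
    simp
    ring

/-- The Koszul formula as a bilinear form in the values of `X` and `Z` at `x`. -/
def koszulForm {Y : Π x : M, TangentSpace I x} {x : M} (hY : MDiffAt (T% Y) x) :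
    TangentSpace I x →L[ℝ] TangentSpace I x →L[ℝ] ℝ :=
  TensorialAt.mkHom₂ (fun X Z ↦ koszul g X Y Z x) x
    (fun _ hZ ↦ koszul_tensorial_left g hY hZ)
    (fun _ hX ↦ koszul_tensorial_right g hX hY)

lemma koszulForm_apply {X Y Z : Π x : M, TangentSpace I x} {x : M} (hX : MDiffAt (T% X) x)
    (hY : MDiffAt (T% Y) x) (hZ : MDiffAt (T% Z) x) :
    koszulForm g hY (X x) (Z x) = koszul g X Y Z x :=
  TensorialAt.mkHom₂_apply _ _ hX hZ

instance (x : M) : FiniteDimensional ℝ (TangentSpace I x) :=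
  inferInstanceAs (FiniteDimensional ℝ E)

instance (x : M) : T2Space (TangentSpace I x) := inferInstanceAs (T2Space E)

lemma metric_ext {x : M} {v w : TangentSpace I x}
    (h : ∀ z, g.inner x v z = g.inner x w z) : v = w := by
  by_contra hne
  have h1 := g.pos x (v - w) (sub_ne_zero.2 hne)
  have h2 : g.inner x (v - w) (v - w) = g.inner x v (v - w) - g.inner x w (v - w) := by
    rw [map_sub (g.inner x)]; rfl
  rw [h2, h (v - w), sub_self] at h1
  exact lt_irrefl _ h1

/-- The isomorphism of `T_x M` with its dual given by the metric. -/
def flat (x : M) : TangentSpace I x ≃ₗ[ℝ] Module.Dual ℝ (TangentSpace I x) :=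
  LinearEquiv.ofInjectiveOfFinrankEq
    ((ContinuousLinearMap.coeLM ℝ).comp (g.inner x).toLinearMap)
    (fun _ _ h ↦ metric_ext g fun z ↦ congrArg (fun φ : Module.Dual ℝ (TangentSpace I x) ↦ φ z) h)
    Subspace.dual_finrank_eq.symm

lemma flat_apply (x : M) (v w : TangentSpace I x) : flat g x v w = g.inner x v w := rfl

open Classical in
/-- `∇Y` at `x`: the endomorphism `v ↦ ∇_v Y` of `T_x M` with `g(∇_v Y, w)` given by the Koszul
formula (and the value `0` where `Y` is not differentiable). -/
def nablaAt (Y : Π x : M, TangentSpace I x) (x : M) : TangentSpace I x →L[ℝ] TangentSpace I x :=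
  if hY : MDiffAt (T% Y) x then
    LinearMap.toContinuousLinearMap ((flat g x).symm.toLinearMap.comp
      ((ContinuousLinearMap.coeLM ℝ).comp (koszulForm g hY).toLinearMap))
  else 0

lemma metric_nablaAt {X Y Z : Π x : M, TangentSpace I x} {x : M} (hX : MDiffAt (T% X) x)
    (hY : MDiffAt (T% Y) x) (hZ : MDiffAt (T% Z) x) :
    g.inner x (nablaAt g Y x (X x)) (Z x) = koszul g X Y Z x := by
  rw [← koszulForm_apply g hX hY hZ, ← flat_apply]
  simp [nablaAt, hY]

lemma exists_field {x : M} (v : TangentSpace I x) :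
    ∃ X : Π x : M, TangentSpace I x, MDiffAt (T% X) x ∧ X x = v :=
  ⟨FiberBundle.extend E v, FiberBundle.mdifferentiableAt_extend I E v,
    FiberBundle.extend_apply_self E v⟩

/-- The Levi-Civita connection of `g`, as a covariant derivative on the tangent bundle.
The value `∇_X Y` at `x` is `leviCivita g Y x (X x)`. -/
def leviCivita : CovariantDerivative I E (TangentSpace I : M → Type _) where
  toFun := nablaAt g
  isCovariantDerivativeOnUniv :=
    { add := by
        intro Y Y' x hY hY' _
        ext v
        refine metric_ext g fun w ↦ ?_
        obtain ⟨X, hX, rfl⟩ := exists_field v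
        obtain ⟨Z, hZ, rfl⟩ := exists_field w
        have h : g.inner x ((nablaAt g Y x + nablaAt g Y' x) (X x)) (Z x)
            = g.inner x (nablaAt g Y x (X x)) (Z x)
              + g.inner x (nablaAt g Y' x (X x)) (Z x) := by
          simp
        rw [h, metric_nablaAt g hX hY hZ, metric_nablaAt g hX hY' hZ,
          metric_nablaAt g hX (mdifferentiableAt_add_section hY hY') hZ]
        have h1 : (fun y ↦ g.inner y ((Y + Y') y) (Z y))
            = fun y ↦ g.inner y (Y y) (Z y) + g.inner y (Y' y) (Z y) := by
          ext y; simp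
        have h2 : (fun y ↦ g.inner y (X y) ((Y + Y') y))
            = fun y ↦ g.inner y (X y) (Y y) + g.inner y (X y) (Y' y) := by
          ext y; simp
        simp only [koszul, h1, h2]
        rw [mvfderiv_fun_add (mdifferentiableAt_metric g hY hZ) (mdifferentiableAt_metric g hY' hZ),
          mvfderiv_fun_add (mdifferentiableAt_metric g hX hY) (mdifferentiableAt_metric g hX hY'),
          mlieBracket_add_right hY hY', mlieBracket_add_left hY hY']
        simp
        ring
      leibniz := by
        intro Y f x hY hf _
        ext v
        refine metric_ext g fun w ↦ ?_
        obtain ⟨X, hX, rfl⟩ := exists_field v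
        obtain ⟨Z, hZ, rfl⟩ := exists_field w
        have h : g.inner x ((f x • nablaAt g Y x + (d% f x).smulRight (Y x)) (X x)) (Z x)
            = f x * g.inner x (nablaAt g Y x (X x)) (Z x)
              + d% f x (X x) * g.inner x (Y x) (Z x) := by
          simp
        rw [h, metric_nablaAt g hX hY hZ, metric_nablaAt g hX (hf.smul_section hY) hZ]
        have h1 : (fun y ↦ g.inner y ((f • Y) y) (Z y))
            = fun y ↦ f y * g.inner y (Y y) (Z y) := by
          ext y; simp
        have h2 : (fun y ↦ g.inner y (X y) ((f • Y) y))
            = fun y ↦ f y * g.inner y (X y) (Y y) := by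
          ext y; simp
        simp only [koszul, h1, h2]
        rw [mvfderiv_fun_mul hf (mdifferentiableAt_metric g hY hZ),
          mvfderiv_fun_mul hf (mdifferentiableAt_metric g hX hY),
          mlieBracket_smul_right hf hY, mlieBracket_smul_left hf hY]
        simp
        rw [g.symm x (Y x) (X x)]
        ring }

/-- The Levi-Civita connection is torsion-free. -/
theorem leviCivita_torsion_free {X Y : Π x : M, TangentSpace I x} {x : M}
    (hX : MDiffAt (T% X) x) (hY : MDiffAt (T% Y) x) :
    leviCivita g Y x (X x) - leviCivita g X x (Y x) = mlieBracket I X Y x := by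
  refine metric_ext g fun w ↦ ?_
  obtain ⟨Z, hZ, rfl⟩ := exists_field w
  have h : g.inner x (leviCivita g Y x (X x) - leviCivita g X x (Y x)) (Z x)
      = g.inner x (nablaAt g Y x (X x)) (Z x) - g.inner x (nablaAt g X x (Y x)) (Z x) := by
    rw [map_sub (g.inner x)]; rfl
  rw [h, metric_nablaAt g hX hY hZ, metric_nablaAt g hY hX hZ]
  have h1 : (fun y ↦ g.inner y (Y y) (X y)) = fun y ↦ g.inner y (X y) (Y y) :=
    funext fun y ↦ g.symm y _ _
  have h2 : g.inner x (mlieBracket I Y X x) (Z x) = - g.inner x (mlieBracket I X Y x) (Z x) := by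
    rw [mlieBracket_swap_apply, map_neg (g.inner x)]; rfl
  simp only [koszul, h1, h2]
  ring

/-- The Levi-Civita connection is compatible with the metric. -/
theorem leviCivita_metric {X Y Z : Π x : M, TangentSpace I x} {x : M}
    (hX : MDiffAt (T% X) x) (hY : MDiffAt (T% Y) x) (hZ : MDiffAt (T% Z) x) :
    d% (fun y ↦ g.inner y (Y y) (Z y)) x (X x)
      = g.inner x (leviCivita g Y x (X x)) (Z x) + g.inner x (Y x) (leviCivita g Z x (X x)) := by
  have h : g.inner x (Y x) (leviCivita g Z x (X x)) = koszul g X Z Y x := by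
    rw [g.symm]; exact metric_nablaAt g hX hZ hY
  have h' : g.inner x (leviCivita g Y x (X x)) (Z x) = koszul g X Y Z x :=
    metric_nablaAt g hX hY hZ
  have h1 : (fun y ↦ g.inner y (Z y) (Y y)) = fun y ↦ g.inner y (Y y) (Z y) :=
    funext fun y ↦ g.symm y _ _
  have h2 : g.inner x (mlieBracket I Z Y x) (X x) = - g.inner x (mlieBracket I Y Z x) (X x) := by
    rw [mlieBracket_swap_apply, map_neg (g.inner x)]; rfl
  rw [h, h']
  simp only [koszul, h1, h2]
  ring

/-- The vector field `∇_X Y`. -/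
def nabla (X Y : Π x : M, TangentSpace I x) : Π x : M, TangentSpace I x :=
  fun x ↦ leviCivita g Y x (X x)

/-- The curvature `R_{X,Y} Z = ∇_X ∇_Y Z - ∇_Y ∇_X Z - ∇_{[X,Y]} Z`. -/
def curvature (X Y Z : Π x : M, TangentSpace I x) : Π x : M, TangentSpace I x :=
  nabla g X (nabla g Y Z) - nabla g Y (nabla g X Z) - nabla g (mlieBracket I X Y) Z

/-! ### Smooth fields, and weak nearly `C`-structures -/

variable (I M) in
/-- A `(1,1)`-tensor field: an endomorphism of every tangent space. -/
abbrev EndField := Π x : M, TangentSpace I x →L[ℝ] TangentSpace I x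

/-- The vector field `X` is smooth. -/
def SmoothField (X : Π x : M, TangentSpace I x) : Prop :=
  ContMDiff I (I.prod 𝓘(ℝ, E)) ∞ (fun x ↦ TotalSpace.mk' E x (X x))

/-- The `(1,1)`-tensor field `T` is smooth. -/
def SmoothEndField (T : EndField I M) : Prop :=
  ContMDiff I (I.prod 𝓘(ℝ, E →L[ℝ] E)) ∞
    (fun x ↦ TotalSpace.mk' (E →L[ℝ] E)
      (E := fun x : M ↦ TangentSpace I x →L[ℝ] TangentSpace I x) x (T x))

/-- The 1-form `η` is smooth. -/
def SmoothForm (η : Π x : M, TangentSpace I x →L[ℝ] ℝ) : Prop :=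
  ContMDiff I (I.prod 𝓘(ℝ, E →L[ℝ] ℝ)) ∞
    (fun x ↦ TotalSpace.mk' (E →L[ℝ] ℝ)
      (E := fun x : M ↦ TangentSpace I x →L[ℝ] Bundle.Trivial M ℝ x) x (η x))

/-- The vector field `T X`. -/
def EndField.app (T : EndField I M) (X : Π x : M, TangentSpace I x) : Π x : M, TangentSpace I x :=
  fun x ↦ T x (X x)

/-- The covariant derivative `(∇_X T) Y = ∇_X (T Y) - T (∇_X Y)` of a `(1,1)`-tensor field. -/
def nablaEnd (T : EndField I M) (X Y : Π x : M, TangentSpace I x) : Π x : M, TangentSpace I x :=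
  nabla g X (T.app Y) - T.app (nabla g X Y)

/-- A weak metric `f`-structure `(f, Q, ξ, η, g)` on a manifold `M` of dimension `2n + s`. -/
structure IsWeakMetricFStructure (n s : ℕ) (f Q : EndField I M)
    (ξ : Fin s → Π x : M, TangentSpace I x) (η : Fin s → Π x : M, TangentSpace I x →L[ℝ] ℝ) :
    Prop where
  n_pos : 0 < n
  s_pos : 0 < s
  dim : finrank ℝ E = 2 * n + s
  smooth_f : SmoothEndField f
  smooth_Q : SmoothEndField Q
  smooth_ξ : ∀ i, SmoothField (ξ i)
  smooth_η : ∀ i, SmoothForm (η i)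
  skew_f : ∀ (x : M) (v w : TangentSpace I x), g.inner x (f x v) w = - g.inner x v (f x w)
  rank_f : ∀ x : M, finrank ℝ (LinearMap.range (f x).toLinearMap) = 2 * n
  selfAdjoint_Q : ∀ (x : M) (v w : TangentSpace I x), g.inner x (Q x v) w = g.inner x v (Q x w)
  nonsingular_Q : ∀ x : M, Function.Bijective (Q x)
  orthonormal_ξ : ∀ (x : M) (i j : Fin s), g.inner x (ξ i x) (ξ j x) = if i = j then 1 else 0
  f_sq : ∀ (x : M) (v : TangentSpace I x), f x (f x v) = - Q x v + ∑ i, η i x v • ξ i x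
  η_ξ : ∀ (x : M) (i j : Fin s), η i x (ξ j x) = if i = j then 1 else 0
  Q_ξ : ∀ (x : M) (i : Fin s), Q x (ξ i x) = ξ i x
  metric_f : ∀ (x : M) (v w : TangentSpace I x),
    g.inner x (f x v) (f x w) = g.inner x v (Q x w) - ∑ i, η i x v * η i x w

/-- A weak nearly `C`-structure: a weak metric `f`-structure with
`(∇_X f) Y + (∇_Y f) X = 0` for all smooth vector fields `X`, `Y`. -/
structure IsWeakNearlyC (n s : ℕ) (f Q : EndField I M)
    (ξ : Fin s → Π x : M, TangentSpace I x) (η : Fin s → Π x : M, TangentSpace I x →L[ℝ] ℝ) :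
    Prop extends IsWeakMetricFStructure g n s f Q ξ η where
  nearly : ∀ X Y : Π x : M, TangentSpace I x, SmoothField X → SmoothField Y →
    nablaEnd g f X Y + nablaEnd g f Y X = 0

/-- `X` is a section of the contact distribution `D`, the common kernel of the forms `η i`. -/
def InContact {s : ℕ} (η : Fin s → Π x : M, TangentSpace I x →L[ℝ] ℝ)
    (X : Π x : M, TangentSpace I x) : Prop :=
  ∀ (x : M) (i : Fin s), η i x (X x) = 0

/-- `(∇_X Q) Y = 0` for all `X` and all `Y` in the contact distribution. -/
def QParallelOnContact {s : ℕ} (Q : EndField I M)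
    (η : Fin s → Π x : M, TangentSpace I x →L[ℝ] ℝ) : Prop :=
  ∀ X Y : Π x : M, TangentSpace I x, SmoothField X → SmoothField Y → InContact η Y →
    nablaEnd g Q X Y = 0

/-- With `Q̃ = Q - id`: `R_{Q̃X,Y} Z` lies in the contact distribution whenever
`X`, `Y`, `Z` do. -/
def QCurvatureInvariant {s : ℕ} (Q : EndField I M)
    (η : Fin s → Π x : M, TangentSpace I x →L[ℝ] ℝ) : Prop :=
  ∀ X Y Z : Π x : M, TangentSpace I x, SmoothField X → SmoothField Y → SmoothField Z →
    InContact η X → InContact η Y → InContact η Z →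
    InContact η (curvature g (Q.app X - X) Y Z)

/-- The contact distribution is curvature invariant: `R_{X,Y} Z` lies in it whenever
`X`, `Y`, `Z` do. -/
def ContactCurvatureInvariant {s : ℕ} (η : Fin s → Π x : M, TangentSpace I x →L[ℝ] ℝ) : Prop :=
  ∀ X Y Z : Π x : M, TangentSpace I x, SmoothField X → SmoothField Y → SmoothField Z →
    InContact η X → InContact η Y → InContact η Z → InContact η (curvature g X Y Z)

end WeakNearlyC

end

/-! ### Curvature identities in an algebraic model of the Levi-Civita connection. -/

namespace WeakNearlyC

/-! Put T(W; X, Y, Z) = g((∇²_{W,X} f) Y, Z). Skewness of f and the nearly condition make T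
alternating in X, Y, Z. The Ricci identity and pair symmetry of R then show that f, acting on R as a
derivation, yields the alternation of T over all four arguments. This is a 4-form which also
satisfies the first Bianchi identity, hence it is zero (`curv_derivation`).

For curvature invariance, consider the form g(R_{X,Y} Z, ξ_i) on D. The hypothesis on R and the
Bianchi identity make f² act as -1 in each of its three slots, so f has eigenvalues ±i there. Since
f ξ_i = 0, the derivation identity says that the three actions of f add up to zero; but a sum of
three numbers ±i is never zero, so the form vanishes (`curv_contact`). Pair symmetry then gives (1).

For (2), put a_i = ∇_{ξ_i} f, which is f composed with X ↦ ∇_X ξ_i. If the ξ_i commute and Q is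
parallel, then ∇_{ξ_i} ξ_j = 0, a_i anticommutes with f, f² a_i = -a_i, and R_{ξ_i,ξ_j} = -2 [a_i,
a_j] (`curv_eq_bracket`). The Jacobi identity for ∇_{ξ_i}, ∇_{ξ_j} and a_i turns this into [a_i,
[a_i, a_j]] = 0 (`double_bracket`), and for skew endomorphisms of a Euclidean space a trace argument
gives [a_i, a_j] = 0 (`LinearMap.commutator_eq_zero_of_skew`).

Only that last step is pointwise and needs finite dimension. The earlier ones are ℝ-linear
identities between fields, proved in the model `LeviCivitaData`, which `leviCivitaData` realises on
the manifold. -/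

/-- An algebraic model of the Levi-Civita connection: `V` plays the role of the smooth vector
fields, `C` of the smooth functions. -/
structure LeviCivitaData (V C : Type*) [AddCommGroup V] [Module ℝ V]
    [AddCommGroup C] [Module ℝ C] where
  /-- The metric. -/
  met : V →ₗ[ℝ] V →ₗ[ℝ] C
  /-- The action of fields on functions. -/
  der : V → C →ₗ[ℝ] C
  /-- The connection. -/
  con : V →ₗ[ℝ] Module.End ℝ V
  symm : ∀ X Y, met X Y = met Y X
  nondegenerate : ∀ X, met X X = 0 → X = 0
  compat : ∀ X Y Z, der X (met Y Z) = met (con X Y) Z + met Y (con X Z)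
  der_bracket : ∀ X Y c, der (con X Y - con Y X) c = der X (der Y c) - der Y (der X c)
  jacobi : ∀ X Y Z, con X (con Y Z - con Z Y) - con (con Y Z - con Z Y) X
    = con (con X Y - con Y X) Z - con Z (con X Y - con Y X)
      + (con Y (con X Z - con Z X) - con (con X Z - con Z X) Y)

namespace LeviCivitaData

variable {V C : Type*} [AddCommGroup V] [Module ℝ V] [AddCommGroup C] [Module ℝ C]
  (L : LeviCivitaData V C)

lemma ext_met {X Y : V} (h : ∀ Z, L.met X Z = L.met Y Z) : X = Y :=
  sub_eq_zero.1 <| L.nondegenerate _ <| by simp [h]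

/-- The curvature operator. -/
def curv (X Y : V) : Module.End ℝ V :=
  L.con X * L.con Y - L.con Y * L.con X - L.con (L.con X Y - L.con Y X)

lemma curv_apply (X Y Z : V) : L.curv X Y Z
    = L.con X (L.con Y Z) - L.con Y (L.con X Z) - L.con (L.con X Y - L.con Y X) Z := rfl

@[simp] lemma curv_sub_left (X X' Y : V) : L.curv (X - X') Y = L.curv X Y - L.curv X' Y := by
  ext Z
  simp only [curv_apply, map_sub, LinearMap.sub_apply]
  abel

@[simp] lemma curv_zero_left (Y : V) : L.curv 0 Y = 0 := by
  simpa using L.curv_sub_left Y Y Y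

@[simp] lemma curv_neg_left (X Y : V) : L.curv (-X) Y = -L.curv X Y := by
  simpa using L.curv_sub_left 0 X Y

lemma curv_swap (X Y : V) : L.curv X Y = -L.curv Y X := by
  ext Z
  simp only [curv_apply, map_sub, LinearMap.sub_apply, LinearMap.neg_apply]
  abel

/-- Differentiating `L.met Z W` twice by metric compatibility, the mixed first-order terms cancel in
the commutator, and `der_bracket` accounts for the rest. -/
lemma curv_skew (X Y Z W : V) : L.met (L.curv X Y Z) W = -L.met Z (L.curv X Y W) := by
  have h1 := L.der_bracket X Y (L.met Z W)
  have h2 := congrArg (L.der X) (L.compat Y Z W)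
  have h3 := congrArg (L.der Y) (L.compat X Z W)
  rw [L.compat] at h1
  rw [map_add, L.compat X, L.compat X] at h2
  rw [map_add, L.compat Y, L.compat Y] at h3
  simp only [curv_apply, map_sub, LinearMap.sub_apply] at h1 ⊢
  linear_combination (norm := module) h3 - h1 - h2

lemma bianchi (X Y Z : V) : L.curv X Y Z + L.curv Y Z X + L.curv Z X Y = 0 := by
  have h := L.jacobi X Y Z
  simp only [curv_apply, map_sub, LinearMap.sub_apply] at h ⊢
  linear_combination (norm := module) h

lemma met_bianchi (X Y Z W : V) :
    L.met (L.curv X Y Z) W + L.met (L.curv Y Z X) W + L.met (L.curv Z X Y) W = 0 := by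
  simpa using congrArg (fun U ↦ L.met U W) (L.bianchi X Y Z)

lemma met_curv_swap (X Y Z W : V) : L.met (L.curv X Y Z) W = -L.met (L.curv Y X Z) W := by
  rw [L.curv_swap]; simp

lemma met_curv_skew (X Y Z W : V) : L.met (L.curv X Y Z) W = -L.met (L.curv X Y W) Z := by
  rw [L.curv_skew, L.symm]

/-- The octahedron argument: half a signed sum of the Bianchi identities for the four cyclic
rotations of the arguments. The rewrites only bring equal terms to a common form. -/
lemma pair_symm (X Y Z W : V) : L.met (L.curv X Y Z) W = L.met (L.curv Z W X) Y := by
  have h1 := L.met_bianchi X Y Z W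
  have h2 := L.met_bianchi Y Z W X
  have h3 := L.met_bianchi Z W X Y
  have h4 := L.met_bianchi W X Y Z
  rw [L.met_curv_skew Y Z W X, L.met_curv_skew Z W Y X, L.met_curv_swap W Y Z X] at h2
  rw [L.met_curv_skew X Z W Y, L.met_curv_swap X Z Y W, L.met_curv_skew W X Z Y] at h3
  rw [L.met_curv_skew X Y W Z] at h4
  rw [L.met_curv_skew Y W Z X, L.met_curv_swap Y W X Z] at h2
  rw [L.met_curv_swap Y W X Z] at h4
  linear_combination (norm := module) (1 / 2 : ℝ) • (h1 + h2 - h3 - h4)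

/-! ### Covariant derivatives of endomorphisms and the derivation identity. -/

/-- The covariant derivative of an endomorphism. -/
def dEnd (A : Module.End ℝ V) (X : V) : Module.End ℝ V := L.con X * A - A * L.con X

lemma dEnd_def (A : Module.End ℝ V) (X : V) : L.dEnd A X = L.con X * A - A * L.con X := rfl

lemma dEnd_apply (A : Module.End ℝ V) (X Y : V) :
    L.dEnd A X Y = L.con X (A Y) - A (L.con X Y) := rfl

lemma dEnd_skew {A : Module.End ℝ V} (hA : ∀ X Y, L.met (A X) Y = -L.met X (A Y)) (X Y Z : V) :
    L.met (L.dEnd A X Y) Z = -L.met Y (L.dEnd A X Z) := by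
  have h1 := L.compat X (A Y) Z
  have h2 := L.compat X Y (A Z)
  rw [hA Y Z, map_neg] at h1
  simp only [dEnd_apply, map_sub, LinearMap.sub_apply, hA] at h1 ⊢
  linear_combination (norm := module) -h1 - h2

lemma dEnd_symm {A : Module.End ℝ V} (hA : ∀ X Y, L.met (A X) Y = L.met X (A Y)) (X Y Z : V) :
    L.met (L.dEnd A X Y) Z = L.met Y (L.dEnd A X Z) := by
  have h1 := L.compat X (A Y) Z
  have h2 := L.compat X Y (A Z)
  rw [hA Y Z] at h1
  simp only [dEnd_apply, map_sub, LinearMap.sub_apply, hA] at h1 ⊢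
  linear_combination (norm := module) h2 - h1

/-- The second covariant derivative of an endomorphism. -/
def ddEnd (A : Module.End ℝ V) (W X : V) : Module.End ℝ V :=
  L.dEnd (L.dEnd A X) W - L.dEnd A (L.con W X)

/-- The torsion-free bracket built into `curv` absorbs the two first-order correction terms of
`ddEnd`. -/
lemma ricci (A : Module.End ℝ V) (W X : V) :
    L.ddEnd A W X - L.ddEnd A X W = L.curv W X * A - A * L.curv W X := by
  simp only [ddEnd, dEnd, curv, map_sub]
  noncomm_ring

section Nearly

variable {L} {F : Module.End ℝ V} (skew : ∀ X Y, L.met (F X) Y = -L.met X (F Y))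
  (nearly : ∀ X Y, L.dEnd F X Y = -L.dEnd F Y X)

include skew in
lemma ddEnd_skew (W X Y Z : V) :
    L.met (L.ddEnd F W X Y) Z = -L.met (L.ddEnd F W X Z) Y := by
  have h1 := L.dEnd_skew (L.dEnd_skew skew X) W Y Z
  have h2 := L.dEnd_skew skew (L.con W X) Y Z
  rw [L.symm Y] at h1 h2
  simp only [ddEnd, map_sub, LinearMap.sub_apply, h1, h2]
  abel

include nearly in
lemma ddEnd_swap (W X Y : V) : L.ddEnd F W X Y = -L.ddEnd F W Y X := by
  simp only [ddEnd, LinearMap.sub_apply, L.dEnd_apply (L.dEnd F X), L.dEnd_apply (L.dEnd F Y)]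
  rw [nearly X Y, nearly (L.con W X) Y, nearly (L.con W Y) X, map_neg]
  abel

include skew nearly in
/-- The curvature of the Levi-Civita connection is annihilated by the derivation extending a
skew-symmetric endomorphism `F` such that `∇F` is alternating. -/
theorem curv_derivation (X Y Z W : V) :
    L.met (L.curv (F X) Y Z) W + L.met (L.curv X (F Y) Z) W + L.met (L.curv X Y (F Z)) W
      + L.met (L.curv X Y Z) (F W) = 0 := by
  have A : ∀ X Y Z W, L.met (L.curv X Y (F Z)) W + L.met (L.curv X Y Z) (F W)
      = L.met (L.ddEnd F X Y Z) W - L.met (L.ddEnd F Y X Z) W := fun X Y Z W ↦ by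
    have h := congrArg (fun B : Module.End ℝ V ↦ L.met (B Z) W) (L.ricci F X Y)
    simp only [LinearMap.sub_apply, map_sub, Module.End.mul_apply, skew] at h
    rw [h]; abel
  -- The Ricci identity only reaches F in the last two slots; pair symmetry gives the first two.
  have S : ∀ X Y Z W, L.met (L.curv (F X) Y Z) W + L.met (L.curv X (F Y) Z) W
      + L.met (L.curv X Y (F Z)) W + L.met (L.curv X Y Z) (F W)
      = L.met (L.ddEnd F X Y Z) W - L.met (L.ddEnd F Y X Z) W
        + L.met (L.ddEnd F Z W X) Y - L.met (L.ddEnd F W Z X) Y := fun X Y Z W ↦ by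
    have h1 := A X Y Z W
    have h2 := A Z W X Y
    rw [L.pair_symm Z W (F X) Y, L.pair_symm Z W X (F Y)] at h2
    linear_combination (norm := module) h1 + h2
  have sw : ∀ W X Y Z, L.met (L.ddEnd F W X Y) Z = -L.met (L.ddEnd F W Y X) Z := fun W X Y Z ↦ by
    rw [ddEnd_swap nearly W X Y]; simp
  have sk := ddEnd_skew skew
  have hb : L.met (L.curv (F X) Y Z) W + L.met (L.curv Y Z (F X)) W + L.met (L.curv Z (F X) Y) W
      = 0 := L.met_bianchi _ _ _ _
  have hb2 := L.met_bianchi X (F Y) Z W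
  have hb3 := L.met_bianchi X Y (F Z) W
  have hb4 := L.met_bianchi X Y Z (F W)
  have e1 := S X Y Z W
  have e2 := S Y Z X W
  have e3 := S Z X Y W
  -- By alternation in the last three arguments, every second-derivative term reduces, up to sign,
  -- to one of four, one for each outer differentiation direction.
  have p1 : L.met (L.ddEnd F Z W X) Y = L.met (L.ddEnd F Z X Y) W := by rw [sw, sk, neg_neg]
  have p2 : L.met (L.ddEnd F X W Y) Z = L.met (L.ddEnd F X Y Z) W := by rw [sw, sk, neg_neg]
  have p3 : L.met (L.ddEnd F Y W Z) X = -L.met (L.ddEnd F Y X Z) W := by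
    rw [sw, sk, neg_neg, sw]
  have p4 : L.met (L.ddEnd F W X Y) Z = L.met (L.ddEnd F W Z X) Y := by rw [sk W X Y Z, sw W X Z Y, neg_neg]
  have p5 : L.met (L.ddEnd F W Y Z) X = L.met (L.ddEnd F W Z X) Y := by rw [sw W Y Z X, sk W Z Y X, neg_neg]
  have p6 : L.met (L.ddEnd F Y Z X) W = -L.met (L.ddEnd F Y X Z) W := sw _ _ _ _
  have p7 : L.met (L.ddEnd F Z Y X) W = -L.met (L.ddEnd F Z X Y) W := sw _ _ _ _
  have p8 : L.met (L.ddEnd F X Z Y) W = -L.met (L.ddEnd F X Y Z) W := sw _ _ _ _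
  rw [p1] at e1
  rw [p2, p4, p6, p7] at e2
  rw [p3, p5, p8] at e3
  -- The three cyclic instances of `S` now have the same right-hand side, while their left-hand
  -- sides add up to the four Bianchi sums; so three times the goal vanishes.
  linear_combination (norm := module) (1/3 : ℝ) • (2 • e1 - e2 - e3 + hb + hb2 + hb3 + hb4)

end Nearly

end LeviCivitaData
end WeakNearlyC

/-! ### Algebra of weak nearly `C`-structures and curvature invariance. -/

namespace WeakNearlyC

/-- An algebraic model of a weak nearly `C`-structure: `P` is the projection `∑ i, η i ⊗ ξ i`
onto the characteristic distribution. -/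
structure WeakNearlyCData {V C : Type*} [AddCommGroup V] [Module ℝ V] [AddCommGroup C]
    [Module ℝ C] (L : LeviCivitaData V C) {ι : Type*} (F Q P : Module.End ℝ V) (ξ : ι → V) :
    Prop where
  skew : ∀ X Y, L.met (F X) Y = -L.met X (F Y)
  nearly : ∀ X Y, L.dEnd F X Y = -L.dEnd F Y X
  Q_symm : ∀ X Y, L.met (Q X) Y = L.met X (Q Y)
  Q_inj : ∀ X, Q X = 0 → X = 0
  sq : F * F = P - Q
  F_P : F * P = 0
  P_F : P * F = 0
  P_P : P * P = P
  Q_P : Q * P = P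
  P_symm : ∀ X Y, L.met (P X) Y = L.met X (P Y)
  P_ξ : ∀ i, P (ξ i) = ξ i
  P_eq_zero : ∀ X, P X = 0 ↔ ∀ i, L.met X (ξ i) = 0
  orthonormal : ∀ X i j, L.der X (L.met (ξ i) (ξ j)) = 0

namespace WeakNearlyCData

variable {V C : Type*} [AddCommGroup V] [Module ℝ V] [AddCommGroup C] [Module ℝ C]
  {L : LeviCivitaData V C} {ι : Type*} {F Q P : Module.End ℝ V} {ξ : ι → V}
  (h : WeakNearlyCData L F Q P ξ)

include h

lemma F_ξ (i : ι) : F (ξ i) = 0 := by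
  rw [← h.P_ξ i, ← Module.End.mul_apply, h.F_P]; rfl

lemma P_F_apply (X : V) : P (F X) = 0 := by
  rw [← Module.End.mul_apply, h.P_F]; rfl

lemma F_F_apply (X : V) : F (F X) = P X - Q X := by
  rw [← Module.End.mul_apply, h.sq]; rfl

/-- If F X = 0 then F² = P - Q gives Q X = P X = Q (P X), and Q is injective. This is how equations
multiplied by F are cancelled later. -/
lemma eq_P_of_F {X : V} (hX : F X = 0) : X = P X := by
  have h1 := h.F_F_apply X
  have h2 := congrArg (fun A : Module.End ℝ V ↦ A X) h.Q_P
  simp only [Module.End.mul_apply] at h2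
  rw [hX, map_zero] at h1
  refine sub_eq_zero.1 (h.Q_inj _ ?_)
  rw [map_sub, h2, ← neg_sub, ← h1, neg_zero]

lemma F_Q : F * Q = Q * F := by
  have h1 : F * (P - Q) = (P - Q) * F := by rw [← h.sq, mul_assoc]
  rw [mul_sub, sub_mul, h.F_P, h.P_F, zero_sub, zero_sub, neg_inj] at h1
  exact h1

lemma P_Q : P * Q = P := by
  have h1 : P * (F * F) = 0 := by rw [← mul_assoc, h.P_F, zero_mul]
  rw [h.sq, mul_sub, h.P_P, sub_eq_zero] at h1
  exact h1.symm

/-- The contact distribution is curvature invariant as soon as `R_{Q̃X,Y} Z` lies in it. -/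
theorem curv_contact
    (hQ : ∀ X Y Z, P X = 0 → P Y = 0 → P Z = 0 → P (L.curv (Q X - X) Y Z) = 0) {X Y Z : V}
    (hX : P X = 0) (hY : P Y = 0) (hZ : P Z = 0) : P (L.curv X Y Z) = 0 := by
  rw [h.P_eq_zero]
  intro i
  have hQ' : ∀ X Y Z, P X = 0 → P Y = 0 → P Z = 0 →
      L.met (L.curv (Q X) Y Z) (ξ i) = L.met (L.curv X Y Z) (ξ i) := by
    intro X Y Z hX hY hZ
    have := (h.P_eq_zero _).1 (hQ X Y Z hX hY hZ) i
    simpa [sub_eq_zero] using this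
  have hF : ∀ X, P X = 0 → F (F X) = -Q X := fun X hX ↦ by rw [h.F_F_apply, hX, zero_sub]
  have hQ0 : ∀ X, P X = 0 → P (Q X) = 0 := fun X hX ↦ by
    rw [← Module.End.mul_apply, h.P_Q, hX]
  have f1 : ∀ X Y Z, P X = 0 → P Y = 0 → P Z = 0 →
      L.met (L.curv (F (F X)) Y Z) (ξ i) = -L.met (L.curv X Y Z) (ξ i) := by
    intro X Y Z hX hY hZ
    rw [hF X hX]
    simpa using hQ' X Y Z hX hY hZ
  have f2 : ∀ X Y Z, P X = 0 → P Y = 0 → P Z = 0 →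
      L.met (L.curv X (F (F Y)) Z) (ξ i) = -L.met (L.curv X Y Z) (ξ i) := by
    intro X Y Z hX hY hZ
    rw [L.met_curv_swap, f1 Y X Z hY hX hZ, L.met_curv_swap Y, neg_neg]
  -- The third slot is not covered by the hypothesis; Bianchi transfers the relation from the first
  -- two.
  have f3 : ∀ X Y Z, P X = 0 → P Y = 0 → P Z = 0 →
      L.met (L.curv X Y (F (F Z))) (ξ i) = -L.met (L.curv X Y Z) (ξ i) := by
    intro X Y Z hX hY hZ
    have b1 := L.met_bianchi X Y (F (F Z)) (ξ i)
    have b2 := L.met_bianchi X Y Z (ξ i)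
    rw [f2 Y Z X hY hZ hX, f1 Z X Y hZ hX hY] at b1
    linear_combination (norm := module) b1 + b2
  have D : ∀ X Y Z, L.met (L.curv (F X) Y Z) (ξ i) + L.met (L.curv X (F Y) Z) (ξ i)
      + L.met (L.curv X Y (F Z)) (ξ i) = 0 := by
    intro X Y Z
    have := LeviCivitaData.curv_derivation h.skew h.nearly X Y Z (ξ i)
    simpa [h.F_ξ] using this
  have P0 := h.P_F_apply
  -- Apply the derivation identity to (F X, Y, Z), (X, F Y, Z) and (X, Y, F Z). These are three
  -- linear equations in the form and its three versions with F in two slots; the latter are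
  -- eliminated except for F in the first two.
  have g : ∀ X Y Z, P X = 0 → P Y = 0 → P Z = 0 →
      L.met (L.curv X Y Z) (ξ i) = (2 : ℝ) • L.met (L.curv (F X) (F Y) Z) (ξ i) := by
    intro X Y Z hX hY hZ
    have d1 := D (F X) Y Z
    have d2 := D X (F Y) Z
    have d3 := D X Y (F Z)
    rw [f1 X Y Z hX hY hZ] at d1
    rw [f2 X Y Z hX hY hZ] at d2
    rw [f3 X Y Z hX hY hZ] at d3
    linear_combination (norm := module) d3 - d1 - d2
  -- Applying `g` twice brings F² into two slots, where the signs cancel: the form equals four times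
  -- itself.
  have g1 := g X Y Z hX hY hZ
  have g2 := g (F X) (F Y) Z (P0 _) (P0 _) hZ
  rw [f1 _ _ _ hX (by rw [h.F_F_apply, map_sub, hY]; simp [hQ0 Y hY]) hZ,
    f2 _ _ _ hX hY hZ] at g2
  linear_combination (norm := module) (-1/3 : ℝ) • (g1 + (2 : ℝ) • g2)

/-- `Q` is parallel as soon as it is so on the contact distribution. -/
lemma Q_parallel (hQ : ∀ X Y, P Y = 0 → L.dEnd Q X Y = 0) (X : V) : L.dEnd Q X = 0 := by
  have hP : ∀ Y, Q (P Y) = P Y := fun Y ↦ by rw [← Module.End.mul_apply, h.Q_P]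
  have hPD : ∀ Y, P (Y - P Y) = 0 := fun Y ↦ by
    rw [map_sub, ← Module.End.mul_apply P P, h.P_P, sub_self]
  ext Y
  have hY : Y = P Y + (Y - P Y) := by abel
  rw [hY, map_add, hQ X _ (hPD Y), add_zero]
  -- Symmetry of ∇Q handles pairing with the contact component of Z; the remaining block on the
  -- image of P vanishes because Q is self-adjoint and the identity there.
  refine L.ext_met fun Z ↦ ?_
  have hZ : Z = P Z + (Z - P Z) := by abel
  rw [hZ, map_add, L.dEnd_symm h.Q_symm X (P Y) (Z - P Z), hQ X _ (hPD Z)]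
  simp only [L.dEnd_apply, hP, map_sub, LinearMap.sub_apply, h.Q_symm]
  simp

/-! ### The endomorphisms `∇_{ξ i} f`, and the curvature when the `ξ i` commute. -/

section Commuting

variable (hQ : ∀ X, L.dEnd Q X = 0) (comm : ∀ i j, L.con (ξ i) (ξ j) = L.con (ξ j) (ξ i))

include comm in
-- F (∇_{ξ i} ξ j) is skew in i, j by the nearly condition and symmetric by commutation, so ∇_{ξ i}
-- ξ j lies in the image of P. Its components against ξ k are symmetric in i, j and skew in j, k,
-- hence zero.
lemma con_ξ_ξ (i j : ι) : L.con (ξ i) (ξ j) = 0 := by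
  have e : ∀ i j, F (L.con (ξ i) (ξ j)) = 0 := fun i j ↦ by
    have h1 := h.nearly (ξ i) (ξ j)
    simp only [L.dEnd_apply, h.F_ξ, map_zero, zero_sub, neg_neg, comm j i] at h1
    linear_combination (norm := module) (-1/2 : ℝ) • h1
  have s : ∀ i j k, L.met (L.con (ξ i) (ξ j)) (ξ k) = -L.met (L.con (ξ i) (ξ k)) (ξ j) := by
    intro i j k
    have h1 := L.compat (ξ i) (ξ j) (ξ k)
    rw [h.orthonormal, L.symm (ξ j)] at h1
    exact (neg_eq_of_add_eq_zero_left h1.symm).symm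
  rw [h.eq_P_of_F (e i j), h.P_eq_zero]
  intro k
  have h1 := s i j k
  rw [comm i k, s k i j, comm k j, s j k i, comm j i] at h1
  linear_combination (norm := module) (1/2 : ℝ) • h1

/-- `∇_{ξ i} f`, an endomorphism. -/
lemma dEnd_ξ_apply (i : ι) (X : V) : L.dEnd F (ξ i) X = F (L.con X (ξ i)) := by
  rw [h.nearly, L.dEnd_apply, h.F_ξ, map_zero, zero_sub, neg_neg]

lemma met_dEnd_cycle (X Y Z : V) : L.met (L.dEnd F X Y) Z = L.met (L.dEnd F Y Z) X := by
  rw [h.nearly, map_neg, LinearMap.neg_apply, L.dEnd_skew h.skew, neg_neg, L.symm]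

/-- Since ∇F is a 3-form, one may cycle ξ i into the last slot, where the derivative becomes -F (∇_Z
ξ i), orthogonal to the image of P. -/
lemma dEnd_ξ_P (i : ι) : L.dEnd F (ξ i) * P = 0 := by
  have hFP : ∀ X, F (P X) = 0 := fun X ↦ by rw [← Module.End.mul_apply, h.F_P]; rfl
  refine LinearMap.ext fun X ↦ L.ext_met fun Z ↦ ?_
  rw [Module.End.mul_apply, ← h.met_dEnd_cycle, L.dEnd_apply, h.F_ξ, map_zero, zero_sub, map_neg,
    LinearMap.neg_apply, h.skew, hFP]
  simp

/-- By `dEnd_ξ_P`, ∇_{ξ i} preserves the image of P, so (∇P) P = 0; taking adjoints, P (∇P) = 0; and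
P = P² makes ∇P the sum of these two. -/
lemma dEnd_P (i : ι) : L.dEnd P (ξ i) = 0 := by
  have h1 : F * (L.con (ξ i) * P) = 0 := by
    have := h.dEnd_ξ_P i
    rw [LeviCivitaData.dEnd, sub_mul, mul_assoc, h.F_P, mul_zero, zero_sub, neg_eq_zero,
      mul_assoc] at this
    exact this
  have h2 : L.con (ξ i) * P = P * (L.con (ξ i) * P) :=
    LinearMap.ext fun X ↦ h.eq_P_of_F (congrArg (fun A : Module.End ℝ V ↦ A X) h1)
  have h3 : L.dEnd P (ξ i) * P = 0 := by
    rw [LeviCivitaData.dEnd, sub_mul, mul_assoc, h.P_P, mul_assoc, ← h2, sub_self]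
  have h4 : P * L.dEnd P (ξ i) = 0 := by
    refine LinearMap.ext fun X ↦ L.ext_met fun Z ↦ ?_
    rw [Module.End.mul_apply, h.P_symm, L.dEnd_symm h.P_symm, ← Module.End.mul_apply, h3]
    simp
  have h5 : L.dEnd P (ξ i) = L.dEnd P (ξ i) * P + P * L.dEnd P (ξ i) := by
    conv_lhs => rw [← h.P_P]
    simp only [LeviCivitaData.dEnd]
    noncomm_ring
  rw [h5, h3, h4, add_zero]

include hQ in
lemma con_F_F (i : ι) : L.con (ξ i) * (F * F) = F * F * L.con (ξ i) := by
  have h1 := h.dEnd_P i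
  have h2 := hQ (ξ i)
  rw [LeviCivitaData.dEnd, sub_eq_zero] at h1 h2
  rw [h.sq, mul_sub, sub_mul, h1, h2]

include hQ in
-- The Leibniz rule for F² = P - Q, which is parallel along ξ i.
lemma dEnd_anticomm (i : ι) : L.dEnd F (ξ i) * F = -(F * L.dEnd F (ξ i)) := by
  have h1 := h.con_F_F hQ i
  rw [← sub_eq_zero] at h1 ⊢
  rw [← h1, LeviCivitaData.dEnd]
  noncomm_ring

lemma Q_ξ (i : ι) : Q (ξ i) = ξ i := by
  rw [← h.P_ξ i, ← Module.End.mul_apply, h.Q_P]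

lemma P_dEnd (i : ι) : P * L.dEnd F (ξ i) = 0 := by
  ext X
  rw [Module.End.mul_apply, h.dEnd_ξ_apply, h.P_F_apply]; rfl

include hQ in
lemma Q_con_ξ (X : V) (i : ι) : Q (L.con X (ξ i)) = L.con X (ξ i) := by
  have := congrArg (fun A : Module.End ℝ V ↦ A (ξ i)) (hQ X)
  simp only [L.dEnd_apply, h.Q_ξ] at this
  exact (sub_eq_zero.1 this).symm

include hQ in
-- Q fixes ∇_X (ξ i) and commutes with F, so it fixes the image of ∇_{ξ i} F, on which P vanishes.
-- Thus F acts there as a complex structure.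
lemma F_F_dEnd (i : ι) : F * F * L.dEnd F (ξ i) = -L.dEnd F (ξ i) := by
  rw [h.sq, sub_mul, h.P_dEnd, zero_sub, neg_inj]
  ext X
  rw [Module.End.mul_apply, h.dEnd_ξ_apply, ← Module.End.mul_apply, ← h.F_Q, Module.End.mul_apply,
    h.Q_con_ξ hQ]

omit h in
/-- The endomorphism `X ↦ ∇_X (ξ i)`. -/
def shape (L : LeviCivitaData V C) (ξ : ι → V) (i : ι) : Module.End ℝ V :=
  LinearMap.flip (R₂ := ℝ) (M := V) (N := V) (P := V) L.con (ξ i)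

omit h in
lemma shape_apply (i : ι) (X : V) : shape L ξ i X = L.con X (ξ i) := rfl

lemma F_shape (i : ι) : F * shape L ξ i = L.dEnd F (ξ i) := by
  ext X; rw [h.dEnd_ξ_apply]; rfl

include hQ in
lemma dEnd_shape (i j : ι) :
    L.dEnd F (ξ i) * shape L ξ j = F * (L.dEnd F (ξ i) * L.dEnd F (ξ j)) := by
  have h1 : shape L ξ j = P * shape L ξ j - F * L.dEnd F (ξ j) := by
    rw [← h.F_shape j, ← mul_assoc, h.sq, sub_mul, sub_sub_cancel]
    ext X
    exact (h.Q_con_ξ hQ X j).symm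
  rw [h1, mul_sub, ← mul_assoc, h.dEnd_ξ_P, zero_mul, zero_sub, ← mul_assoc, h.dEnd_anticomm hQ,
    neg_mul, neg_neg, mul_assoc]

omit h in
/-- The endomorphism `X ↦ R_{ξ i, X} (ξ j)`, for commuting `ξ`. -/
def jacobiEnd (L : LeviCivitaData V C) (ξ : ι → V) (i j : ι) : Module.End ℝ V :=
  L.con (ξ i) * shape L ξ j - shape L ξ j * L.con (ξ i) + shape L ξ j * shape L ξ i

include comm in
lemma jacobiEnd_apply (i j : ι) (X : V) : jacobiEnd L ξ i j X = L.curv (ξ i) X (ξ j) := by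
  simp only [jacobiEnd, L.curv_apply, h.con_ξ_ξ comm, LinearMap.sub_apply, LinearMap.add_apply,
    Module.End.mul_apply, shape_apply, map_sub, map_zero]
  abel

include comm in
-- In the derivation identity the two slots holding ξ i and ξ j drop out because F kills them.
lemma jacobiEnd_F (i j : ι) : jacobiEnd L ξ i j * F = F * jacobiEnd L ξ i j := by
  refine LinearMap.ext fun X ↦ L.ext_met fun Z ↦ ?_
  have := LeviCivitaData.curv_derivation h.skew h.nearly (ξ i) X (ξ j) Z
  rw [h.F_ξ, h.F_ξ, L.curv_zero_left] at this
  simp only [LinearMap.zero_apply, map_zero, zero_add, add_zero] at this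
  rw [Module.End.mul_apply, Module.End.mul_apply, h.jacobiEnd_apply comm, h.skew,
    h.jacobiEnd_apply comm, eq_neg_iff_add_eq_zero, this]

include hQ in
lemma F_jacobiEnd (i j : ι) : F * jacobiEnd L ξ i j = L.dEnd (L.dEnd F (ξ j)) (ξ i)
    - F * (L.dEnd F (ξ i) * L.dEnd F (ξ j)) + F * (L.dEnd F (ξ j) * L.dEnd F (ξ i)) := by
  rw [← h.dEnd_shape hQ i j, ← h.dEnd_shape hQ j i, jacobiEnd]
  have h1 : F * L.con (ξ i) = L.con (ξ i) * F - L.dEnd F (ξ i) := by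
    rw [LeviCivitaData.dEnd]; abel
  rw [mul_add, mul_sub, ← mul_assoc, ← mul_assoc, ← mul_assoc, h1, h.F_shape, sub_mul, mul_assoc,
    h.F_shape, L.dEnd_def (L.dEnd F (ξ j))]
  abel

include hQ comm in
-- With a, b the derivatives of F along ξ i, ξ j and S that of b along ξ i, differentiating b F + F
-- b = 0 gives S F + F S = -(a b + b a). Since S commutes with F and F² S = -S, multiplying by F
-- isolates S.
lemma two_smul_dEnd_dEnd (i j : ι) : (2 : ℝ) • L.dEnd (L.dEnd F (ξ j)) (ξ i)
    = F * (L.dEnd F (ξ i) * L.dEnd F (ξ j) + L.dEnd F (ξ j) * L.dEnd F (ξ i)) := by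
  have hS := h.F_jacobiEnd hQ i j
  have hB := h.jacobiEnd_F comm i j
  have a1 := h.dEnd_anticomm hQ i
  have a2 := h.dEnd_anticomm hQ j
  have q2 := h.F_F_dEnd hQ j
  have c := h.con_F_F hQ i
  have d : L.dEnd (L.dEnd F (ξ j) * F + F * L.dEnd F (ξ j)) (ξ i) = 0 := by
    rw [a2, neg_add_cancel, LeviCivitaData.dEnd, mul_zero, zero_mul, sub_zero]
  have d' : L.dEnd (L.dEnd F (ξ j)) (ξ i) * F + L.dEnd F (ξ j) * L.dEnd F (ξ i)
      + L.dEnd F (ξ i) * L.dEnd F (ξ j) + F * L.dEnd (L.dEnd F (ξ j)) (ξ i) = 0 := by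
    rw [← d]
    simp only [LeviCivitaData.dEnd]
    noncomm_ring
  have ff : F * (F * L.dEnd (L.dEnd F (ξ j)) (ξ i)) = -L.dEnd (L.dEnd F (ξ j)) (ξ i) := by
    rw [L.dEnd_def (L.dEnd F (ξ j)), mul_sub, mul_sub, ← mul_assoc F F, ← mul_assoc F F,
      ← mul_assoc, ← mul_assoc, q2, ← c, mul_assoc _ (F * F), q2]
    noncomm_ring
  generalize L.dEnd (L.dEnd F (ξ j)) (ξ i) = S at *
  generalize L.dEnd F (ξ i) = a at *
  generalize L.dEnd F (ξ j) = b at *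
  generalize jacobiEnd L ξ i j = B at *
  have ab : a * b * F = F * (a * b) := by
    rw [mul_assoc, a2, mul_neg, ← mul_assoc, a1, neg_mul, neg_neg, mul_assoc]
  have ba : b * a * F = F * (b * a) := by
    rw [mul_assoc, a1, mul_neg, ← mul_assoc, a2, neg_mul, neg_neg, mul_assoc]
  -- Each factor on the right commutes with F, hence so does S.
  have hS' : S = F * (B + a * b - b * a) := by
    rw [mul_sub, mul_add, hS]; abel
  have hSF : S * F = F * S := by
    rw [hS', mul_assoc, sub_mul, add_mul, hB, ab, ba]
    noncomm_ring
  rw [hSF] at d'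
  have d2 : F * (F * S + b * a + a * b + F * S) = 0 := by rw [d', mul_zero]
  rw [mul_add, mul_add, mul_add, ff] at d2
  rw [mul_add]
  linear_combination (norm := module) -d2

include comm in
lemma curv_ξ_ξ (i j : ι) : L.curv (ξ i) (ξ j)
    = L.con (ξ i) * L.con (ξ j) - L.con (ξ j) * L.con (ξ i) := by
  rw [LeviCivitaData.curv, h.con_ξ_ξ comm, h.con_ξ_ξ comm, sub_zero, map_zero, sub_zero]

include hQ comm in
-- Bianchi writes the curvature as the antisymmetrised `jacobiEnd`. After multiplication by F the
-- second derivatives cancel, being symmetric in i, j; as P annihilates both sides, F can be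
-- cancelled.
lemma curv_eq_bracket (i j : ι) : L.curv (ξ i) (ξ j)
    = (-2 : ℝ) • (L.dEnd F (ξ i) * L.dEnd F (ξ j) - L.dEnd F (ξ j) * L.dEnd F (ξ i)) := by
  have hB : L.curv (ξ i) (ξ j) = jacobiEnd L ξ i j - jacobiEnd L ξ j i := by
    ext X
    rw [LinearMap.sub_apply, h.jacobiEnd_apply comm, h.jacobiEnd_apply comm]
    have := L.bianchi (ξ i) (ξ j) X
    rw [L.curv_swap X] at this
    simp only [LinearMap.neg_apply] at this
    linear_combination (norm := module) this
  have hP : P * L.curv (ξ i) (ξ j) = 0 := by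
    ext X
    rw [Module.End.mul_apply, LinearMap.zero_apply, h.P_eq_zero]
    intro k
    rw [L.curv_skew, h.curv_ξ_ξ comm]
    simp [h.con_ξ_ξ comm]
  have hF : F * (L.curv (ξ i) (ξ j)
      + (2 : ℝ) • (L.dEnd F (ξ i) * L.dEnd F (ξ j) - L.dEnd F (ξ j) * L.dEnd F (ξ i))) = 0 := by
    have s1 := h.two_smul_dEnd_dEnd hQ comm i j
    have s2 := h.two_smul_dEnd_dEnd hQ comm j i
    have s3 := h.F_jacobiEnd hQ i j
    have s4 := h.F_jacobiEnd hQ j i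
    rw [hB, mul_add, mul_sub, s3, s4, mul_smul_comm, mul_sub]
    rw [mul_add] at s1 s2
    linear_combination (norm := module) (1/2 : ℝ) • (s1 - s2)
  have hU := fun X ↦ h.eq_P_of_F (congrArg (fun A : Module.End ℝ V ↦ A X) hF)
  rw [neg_smul, eq_neg_iff_add_eq_zero]
  ext X
  rw [hU X, ← Module.End.mul_apply, mul_add, hP, mul_smul_comm, mul_sub, ← mul_assoc, ← mul_assoc,
    h.P_dEnd, h.P_dEnd]
  simp

include hQ comm in
/-- The endomorphisms `∇_{ξ i} f` satisfy a double commutator relation. -/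
theorem double_bracket (i j : ι) :
    L.dEnd F (ξ i) * (L.dEnd F (ξ i) * L.dEnd F (ξ j) - L.dEnd F (ξ j) * L.dEnd F (ξ i))
      = (L.dEnd F (ξ i) * L.dEnd F (ξ j) - L.dEnd F (ξ j) * L.dEnd F (ξ i)) * L.dEnd F (ξ i) := by
  have hR := h.curv_eq_bracket hQ comm i j
  rw [h.curv_ξ_ξ comm] at hR
  have s1 := h.two_smul_dEnd_dEnd hQ comm i j
  have s2 := h.two_smul_dEnd_dEnd hQ comm j i
  have s3 := h.two_smul_dEnd_dEnd hQ comm i i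
  have a1 := h.dEnd_anticomm hQ i
  have a2 := h.dEnd_anticomm hQ j
  have q1 := h.F_F_dEnd hQ i
  have q2 := h.F_F_dEnd hQ j
  have ei := L.dEnd_def F (ξ i)
  have ej := L.dEnd_def F (ξ j)
  rw [L.dEnd_def (L.dEnd F (ξ _))] at s1 s2 s3
  generalize L.dEnd F (ξ i) = a at *
  generalize L.dEnd F (ξ j) = b at *
  generalize L.con (ξ i) = N at *
  generalize L.con (ξ j) = K at *
  have Fa : ∀ X, F * (a * (F * X)) = -(F * (F * (a * X))) := fun X ↦ by
    rw [← mul_assoc a, a1, neg_mul, mul_neg, mul_assoc]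
  have Fb : ∀ X, F * (b * (F * X)) = -(F * (F * (b * X))) := fun X ↦ by
    rw [← mul_assoc b, a2, neg_mul, mul_neg, mul_assoc]
  have FFa : ∀ X, F * (F * (a * X)) = -(a * X) := fun X ↦ by
    rw [← mul_assoc, ← mul_assoc, q1, neg_mul]
  have FFb : ∀ X, F * (F * (b * X)) = -(b * X) := fun X ↦ by
    rw [← mul_assoc, ← mul_assoc, q2, neg_mul]
  have hS : N * b - b * N = (1 / 2 : ℝ) • (F * (a * b + b * a)) := by
    rw [← s1]; module
  have hS' : K * a - a * K = (1 / 2 : ℝ) • (F * (a * b + b * a)) := by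
    rw [add_comm (a * b), ← s2]; module
  have hT : N * a - a * N = F * (a * a) := by
    have : F * (a * a) = (1 / 2 : ℝ) • (F * (a * a + a * a)) := by rw [mul_add]; module
    rw [this, ← s3]; module
  have e1 : N * (F * (a * b + b * a)) - F * (a * b + b * a) * N
      = a * (a * b + b * a) + F * (F * (a * a) * b + a * ((1 / 2 : ℝ) • (F * (a * b + b * a)))
        + (1 / 2 : ℝ) • (F * (a * b + b * a)) * a + b * (F * (a * a))) := by
    rw [← hS, ← hT]
    conv_rhs => enter [1, 1]; rw [ei]
    noncomm_ring
  have e2 : K * (F * (a * a)) - F * (a * a) * K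
      = b * (a * a) + F * ((1 / 2 : ℝ) • (F * (a * b + b * a)) * a
        + a * ((1 / 2 : ℝ) • (F * (a * b + b * a)))) := by
    rw [← hS']
    conv_rhs => enter [1, 1]; rw [ej]
    noncomm_ring
  -- The Jacobi identity for N, K, a: the left side is the commutator of the curvature with a, the
  -- right side a derivative of known first derivatives.
  have e3 : (N * K - K * N) * a - a * (N * K - K * N)
      = (N * (K * a - a * K) - (K * a - a * K) * N)
        - (K * (N * a - a * N) - (N * a - a * N) * K) := by noncomm_ring
  rw [hR, hS', hT, e2, mul_smul_comm (1 / 2 : ℝ) N, smul_mul_assoc (1 / 2 : ℝ) _ N,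
    ← smul_sub (1 / 2 : ℝ), e1] at e3
  simp only [mul_add, add_mul, mul_sub, sub_mul, smul_add, smul_sub, mul_smul_comm, smul_mul_assoc,
    mul_assoc, Fa, Fb, FFa, FFb] at e3 ⊢
  -- The left side of `e3` is 2 [a, [a, b]] and the right side -1/4 of it, so 9/4 of the double
  -- commutator is zero.
  linear_combination (norm := module) (4 / 9 : ℝ) • e3

end Commuting

end WeakNearlyCData
end WeakNearlyC

/-! ### Commutators of skew-symmetric endomorphisms -/

/-- For skew-symmetric endomorphisms `a`, `b` of a Euclidean space, `[a, [a, b]] = 0` implies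
`[a, b] = 0`. -/
theorem LinearMap.commutator_eq_zero_of_skew {V : Type*} [AddCommGroup V] [Module ℝ V]
    [FiniteDimensional ℝ V] {B : LinearMap.BilinForm ℝ V} (symm : LinearMap.IsSymm B)
    (pos : ∀ v, v ≠ 0 → 0 < B v v) {a b : Module.End ℝ V}
    (ha : ∀ v w, B (a v) w = -B v (a w)) (hb : ∀ v w, B (b v) w = -B v (b w))
    (hab : a * (a * b - b * a) = (a * b - b * a) * a) : a * b - b * a = 0 := by
  set m := a * b - b * a with hm
  have skew : ∀ v w, B (m v) w = -B v (m w) := fun v w ↦ by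
    simp only [hm, LinearMap.sub_apply, Module.End.mul_apply, map_sub, ha, hb, neg_neg]
    ring
  -- As m commutes with a, m² = [a, b m] is a commutator. For skew m the trace of m² is minus the
  -- squared norm of m, computed below in an orthogonal basis.
  have tr : LinearMap.trace ℝ V (m * m) = 0 := by
    have : m * m = a * (b * m) - b * m * a := by
      rw [mul_assoc b m a, ← hab]
      conv_lhs => enter [1]; rw [hm]
      noncomm_ring
    rw [this, map_sub, LinearMap.trace_mul_comm, sub_self]
  obtain ⟨v, hv⟩ := LinearMap.BilinForm.exists_orthogonal_basis symm
  have coord : ∀ (w : V) i, B (v i) (v i) * v.repr w i = B w (v i) := fun w i ↦ by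
    conv_rhs => rw [← v.sum_repr w, map_sum, LinearMap.sum_apply]
    rw [Finset.sum_eq_single i]
    · simp [mul_comm]
    · intro j _ hj
      have : B (v j) (v i) = 0 := hv hj
      simp [this]
    · simp
  have hvi : ∀ i, 0 < B (v i) (v i) := fun i ↦ pos _ (v.ne_zero i)
  rw [LinearMap.trace_eq_matrix_trace ℝ v, Matrix.trace] at tr
  have nn : ∀ w, 0 ≤ B w w := fun w ↦ by
    by_cases hw : w = 0
    · simp [hw]
    · exact (pos w hw).le
  have term : ∀ i, (LinearMap.toMatrix v v (m * m)).diag i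
      = -(B (m (v i)) (m (v i)) / B (v i) (v i)) := fun i ↦ by
    rw [Matrix.diag_apply, LinearMap.toMatrix_apply, ← neg_div, eq_div_iff (hvi i).ne', mul_comm,
      coord, Module.End.mul_apply, skew]
  simp only [term, Finset.sum_neg_distrib, neg_eq_zero] at tr
  rw [Finset.sum_eq_zero_iff_of_nonneg fun i _ ↦ div_nonneg (nn _) (hvi i).le] at tr
  refine v.ext fun i ↦ ?_
  by_contra hne
  exact (div_pos (pos _ hne) (hvi i)).ne' (tr i (Finset.mem_univ _))

/-! ### Smoothness of the Levi-Civita connection -/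

section Smooth

variable {E : Type*} [NormedAddCommGroup E] [NormedSpace ℝ E]
  {H : Type*} [TopologicalSpace H] {I : ModelWithCorners ℝ E H}
  {M : Type*} [TopologicalSpace M] [ChartedSpace H M]

/-- The determinant of a matrix of smooth functions is smooth. -/
lemma ContMDiffAt.matrix_det {ι : Type*} [Fintype ι] [DecidableEq ι] {A : M → Matrix ι ι ℝ} {x : M}
    (hA : ∀ i j, CMDiffAt ∞ (fun y ↦ A y i j) x) : CMDiffAt ∞ (fun y ↦ (A y).det) x := by
  simp only [Matrix.det_apply']
  exact contMDiffAt_finsetSum fun σ _ ↦ contMDiffAt_const.mul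
    (contMDiffAt_finsetProd fun i _ ↦ hA _ _)

variable [IsManifold I ∞ M]

/-- The derivative of a smooth function along a smooth vector field is smooth. -/
lemma ContMDiffAt.mvfderiv_apply {c : M → ℝ} {X : Π x : M, TangentSpace I x} {x : M}
    (hc : CMDiffAt ∞ c x) (hX : CMDiffAt ∞ (T% X) x) :
    CMDiffAt ∞ (fun y ↦ d% c y (X y)) x := by
  have := IsManifold.of_le (I := I) (M := M) (m := 1) (n := ∞) (by simp)
  have h1 := hc.mfderiv_const (m := ∞) (by simp)
  have h2 := ContMDiffAt.clm_apply_of_inCoordinates (b₁ := id) (b₂ := c) (v := X)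
    (ϕ := fun y ↦ mfderiv% c y) h1 hX hc
  rw [contMDiffAt_totalSpace] at h2
  simpa using! h2.2

/-- Every tangent vector extends to a smooth vector field. -/
lemma exists_smooth_extension [FiniteDimensional ℝ E] [T2Space M] {x : M} (v : TangentSpace I x) :
    ∃ X : Cₛ^∞⟮I; E, (TangentSpace I : M → Type _)⟯, X x = v := by
  obtain ⟨s, hs, hX⟩ := FiberBundle.exists_contMDiffOn_extend (k := ∞) I E v
  obtain ⟨u, hus, hu, hxu⟩ := mem_nhds_iff.1 hs
  obtain ⟨b, -, hb⟩ := (SmoothBumpFunction.nhds_basis_tsupport (I := I) x).mem_iff.1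
    (hu.mem_nhds hxu)
  suffices hs : CMDiff ∞ (T% (fun y ↦ b y • FiberBundle.extend E v y)) from
    ⟨⟨_, hs⟩, by simp [ContMDiffSection.coeFn_mk]⟩
  intro y
  by_cases hy : y ∈ u
  · exact b.contMDiffAt.smul_section ((hX.mono hus).contMDiffAt (hu.mem_nhds hy))
  · have hz : CMDiffAt ∞ (T% (0 : Π x : M, TangentSpace I x)) y :=
      (0 : Cₛ^∞⟮I; E, (TangentSpace I : M → Type _)⟯).contMDiff y
    refine hz.congr_of_eventuallyEq ?_
    filter_upwards [(isClosed_tsupport b).isOpen_compl.mem_nhds fun h ↦ hy (hb h)] with z hz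
    simp [image_eq_zero_of_notMem_tsupport hz]

namespace WeakNearlyC

variable (g : ContMDiffRiemannianMetric I ∞ E (fun x : M ↦ TangentSpace I x))

lemma contMDiffAt_metric {X Y : Π x : M, TangentSpace I x} {x : M}
    (hX : CMDiffAt ∞ (T% X) x) (hY : CMDiffAt ∞ (T% Y) x) :
    CMDiffAt ∞ (fun y ↦ g.inner y (X y) (Y y)) x := by
  have h := g.contMDiff x
  have : ContMDiffAt I (I.prod 𝓘(ℝ, ℝ)) ∞
      (fun m ↦ TotalSpace.mk' ℝ (E := Bundle.Trivial M ℝ) m (g.inner m (X m) (Y m))) x :=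
    ContMDiffAt.clm_bundle_apply₂ (F₁ := E) (F₂ := E) h hX hY
  rw [contMDiffAt_totalSpace] at this
  exact this.2

lemma contMDiffAt_mlieBracket [FiniteDimensional ℝ E] {X Y : Π x : M, TangentSpace I x} {x : M}
    (hX : CMDiffAt ∞ (T% X) x) (hY : CMDiffAt ∞ (T% Y) x) :
    CMDiffAt ∞ (T% (mlieBracket I X Y)) x := by
  have := IsManifold.of_le (I := I) (M := M) (m := minSmoothness ℝ 2) (n := ∞)
    (by simpa using ENat.LEInfty.out)
  have : IsManifold I (((⊤ : ℕ∞) : ℕ∞ω) + 1) M := by simpa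
  have := FiniteDimensional.complete ℝ E
  exact ContMDiffAt.mlieBracket_vectorField (m := ⊤) (n := ⊤) hX hY (by simp)

lemma contMDiffAt_koszul [FiniteDimensional ℝ E] {X Y Z : Π x : M, TangentSpace I x} {x : M}
    (hX : CMDiffAt ∞ (T% X) x) (hY : CMDiffAt ∞ (T% Y) x) (hZ : CMDiffAt ∞ (T% Z) x) :
    CMDiffAt ∞ (koszul g X Y Z) x := by
  have h := ((((((contMDiffAt_metric g hY hZ).mvfderiv_apply hX).add
    ((contMDiffAt_metric g hX hZ).mvfderiv_apply hY)).sub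
    ((contMDiffAt_metric g hX hY).mvfderiv_apply hZ)).add
    (contMDiffAt_metric g (contMDiffAt_mlieBracket hX hY) hZ)).sub
    (contMDiffAt_metric g (contMDiffAt_mlieBracket hX hZ) hY)).sub
    (contMDiffAt_metric g (contMDiffAt_mlieBracket hY hZ) hX)
  exact h.div_const 2

open scoped Matrix in
/-- A vector field is smooth if its inner products with smooth fields are. -/
lemma contMDiffAt_of_metric [FiniteDimensional ℝ E] {W : Π x : M, TangentSpace I x} {x : M}
    (hW : ∀ (u : Set M) (Z : Π x : M, TangentSpace I x), IsOpen u → x ∈ u → CMDiff[u] ∞ (T% Z) →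
      CMDiffAt ∞ (fun y ↦ g.inner y (W y) (Z y)) x) : CMDiffAt ∞ (T% W) x := by
  classical
  set e := trivializationAt E (TangentSpace I : M → Type _) x
  have hx : x ∈ e.baseSet := FiberBundle.mem_baseSet_trivializationAt' x
  set b := Module.finBasis ℝ E
  have hs := e.isLocalFrameOn_localFrame_baseSet I ∞ b
  set Z := e.localFrame b
  have hZ : ∀ i, CMDiffAt ∞ (T% (Z i)) x := fun i ↦ hs.contMDiffAt e.open_baseSet hx i
  -- The frame coefficients of W solve a linear system with the Gram matrix of the frame; Cramer's
  -- rule then expresses them through smooth determinants.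
  let G : M → Matrix _ _ ℝ := fun y ↦ .of fun i j ↦ g.inner y (Z j y) (Z i y)
  let β : M → _ → ℝ := fun y i ↦ g.inner y (W y) (Z i y)
  have hG : ∀ i j, CMDiffAt ∞ (fun y ↦ G y i j) x := fun i j ↦ contMDiffAt_metric g (hZ j) (hZ i)
  have hβ : ∀ i, CMDiffAt ∞ (fun y ↦ β y i) x := fun i ↦
    hW _ _ e.open_baseSet hx (hs.contMDiffOn i)
  have sum_c : ∀ y ∈ e.baseSet, ∀ c : _ → ℝ, ∀ i,
      (G y *ᵥ c) i = g.inner y (∑ j, c j • Z j y) (Z i y) := fun y _ c i ↦ by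
    simp [Matrix.mulVec, dotProduct, G, mul_comm]
  have det_ne : ∀ y ∈ e.baseSet, (G y).det ≠ 0 := fun y hy h0 ↦ by
    obtain ⟨c, hc, hGc⟩ := Matrix.exists_mulVec_eq_zero_iff.2 h0
    have hz : ∑ j, c j • Z j y = 0 := by
      by_contra hne
      have hp := g.pos y _ hne
      have : g.inner y (∑ j, c j • Z j y) (∑ j, c j • Z j y)
          = ∑ i, c i * g.inner y (∑ j, c j • Z j y) (Z i y) := by
        rw [map_sum]; simp
      rw [this] at hp
      simp only [← sum_c y hy, hGc] at hp
      simp at hp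
    exact hc (funext <| Fintype.linearIndependent_iff.1 (hs.linearIndependent hy) c hz)
  refine hs.contMDiffAt_of_coeff (fun i ↦ ?_) (e.open_baseSet.mem_nhds hx)
  have hsm : CMDiffAt ∞ (fun y ↦ ((G y).det)⁻¹ * ((G y).updateCol i (β y)).det) x := by
    refine ((ContMDiffAt.matrix_det hG).inv₀ (det_ne x hx)).mul (ContMDiffAt.matrix_det ?_)
    intro k l
    by_cases hl : l = i
    · subst hl; simpa using hβ k
    · simpa [Matrix.updateCol_ne hl] using hG k l
  refine hsm.congr_of_eventuallyEq ?_
  filter_upwards [e.open_baseSet.mem_nhds hx] with y hy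
  have h1 : G y *ᵥ (fun j ↦ hs.coeff j y (W y)) = β y := funext fun k ↦ by
    rw [sum_c y hy, ← hs.coeff_sum_eq W hy]
  rw [eq_inv_mul_iff_mul_eq₀ (det_ne y hy), ← Matrix.cramer_apply,
    Matrix.cramer_eq_adjugate_mulVec, ← h1, Matrix.mulVec_mulVec, Matrix.adjugate_mul,
    Matrix.smul_mulVec, Matrix.one_mulVec]
  simp

variable [FiniteDimensional ℝ E]

lemma SmoothField.nabla {X Y : Π x : M, TangentSpace I x} (hX : SmoothField X)
    (hY : SmoothField Y) : SmoothField (nabla g X Y) := fun x ↦ by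
  refine contMDiffAt_of_metric g fun u Z hu hx hZ ↦ ?_
  refine (contMDiffAt_koszul g (hX x) (hY x) (hZ.contMDiffAt (hu.mem_nhds hx))).congr_of_eventuallyEq
    ?_
  filter_upwards [hu.mem_nhds hx] with y hy
  exact metric_nablaAt g ((hX y).mdifferentiableAt (by simp)) ((hY y).mdifferentiableAt (by simp))
    ((hZ.contMDiffAt (hu.mem_nhds hy)).mdifferentiableAt (by simp))

omit [FiniteDimensional ℝ E] in
lemma SmoothField.app {T : EndField I M} {X : Π x : M, TangentSpace I x} (hT : SmoothEndField T)
    (hX : SmoothField X) : SmoothField (T.app X) := fun x ↦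
  ContMDiffAt.clm_bundle_apply (F₁ := E) (F₂ := E) (hT x) (hX x)

end WeakNearlyC

end Smooth

/-! ### The smooth vector fields as a model of `LeviCivitaData`. -/

namespace WeakNearlyC

variable {E : Type*} [NormedAddCommGroup E] [NormedSpace ℝ E] [FiniteDimensional ℝ E]
  {H : Type*} [TopologicalSpace H] {I : ModelWithCorners ℝ E H}
  {M : Type*} [TopologicalSpace M] [ChartedSpace H M] [IsManifold I ∞ M]

variable (I M) in
/-- The smooth vector fields. -/
abbrev SmoothFields := Cₛ^∞⟮I; E, (TangentSpace I : M → Type _)⟯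

variable (I M) in
/-- The smooth functions. -/
abbrev SmoothFunctions := C^∞⟮I, M; ℝ⟯

lemma mlieBracket_smul_right' {c : M → ℝ} {X Y : Π x : M, TangentSpace I x}
    (hc : CMDiff ∞ c) (hY : SmoothField Y) :
    mlieBracket I X (c • Y) = (fun x ↦ d% c x (X x)) • Y + c • mlieBracket I X Y := by
  ext x
  exact mlieBracket_smul_right ((hc x).mdifferentiableAt (by simp))
    ((hY x).mdifferentiableAt (by simp))

lemma SmoothField.mlieBracket {X Y : Π x : M, TangentSpace I x} (hX : SmoothField X)
    (hY : SmoothField Y) : SmoothField (mlieBracket I X Y) :=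
  fun x ↦ contMDiffAt_mlieBracket (hX x) (hY x)

omit [FiniteDimensional ℝ E] in
lemma SmoothField.smul {c : M → ℝ} {X : Π x : M, TangentSpace I x} (hc : CMDiff ∞ c)
    (hX : SmoothField X) : SmoothField (c • X) :=
  ContMDiff.smul_section hc hX

lemma jacobi_mlieBracket {X Y Z : Π x : M, TangentSpace I x} (hX : SmoothField X)
    (hY : SmoothField Y) (hZ : SmoothField Z) :
    mlieBracket I X (mlieBracket I Y Z)
      = mlieBracket I (mlieBracket I X Y) Z + mlieBracket I Y (mlieBracket I X Z) := by
  have := IsManifold.of_le (I := I) (M := M) (m := minSmoothness ℝ 3) (n := ∞)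
    (by simpa using ENat.LEInfty.out)
  have := FiniteDimensional.complete ℝ E
  have h2 : minSmoothness ℝ 2 ≤ ∞ := by simpa using ENat.LEInfty.out
  exact leibniz_identity_mlieBracket (ContMDiff.of_le hX h2) (ContMDiff.of_le hY h2)
    (ContMDiff.of_le hZ h2)

omit [FiniteDimensional ℝ E] in
lemma contMDiff_mvfderiv_apply {c : M → ℝ} {X : Π x : M, TangentSpace I x} (hc : CMDiff ∞ c)
    (hX : SmoothField X) : CMDiff ∞ (fun x ↦ d% c x (X x)) :=
  fun x ↦ (hc x).mvfderiv_apply (hX x)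

/-- The derivative of a function along a Lie bracket is the commutator of the derivatives. -/
lemma mvfderiv_mlieBracket [T2Space M] {c : M → ℝ} {X Y : Π x : M, TangentSpace I x}
    (hc : CMDiff ∞ c) (hX : SmoothField X) (hY : SmoothField Y) (x : M) :
    d% c x (mlieBracket I X Y x)
      = d% (fun y ↦ d% c y (Y y)) x (X x) - d% (fun y ↦ d% c y (X y)) x (Y x) := by
  -- Comparing the Jacobi identities for X, Y, Z and X, Y, c Z leaves the desired scalar identity
  -- times Z, so a field Z with Z x ≠ 0 is needed. In a zero tangent space all terms vanish.
  by_cases hv : ∃ v : TangentSpace I x, v ≠ 0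
  · obtain ⟨v, hv⟩ := hv
    obtain ⟨Z, rfl⟩ := exists_smooth_extension v
    have hZ : SmoothField Z := Z.contMDiff
    have hXc := contMDiff_mvfderiv_apply hc hX
    have hYc := contMDiff_mvfderiv_apply hc hY
    have hmd : ∀ {W : Π x : M, TangentSpace I x}, SmoothField W → MDiffAt (T% W) x :=
      fun hW ↦ (hW x).mdifferentiableAt (by simp)
    have h0 := congrFun (jacobi_mlieBracket hX hY hZ) x
    have h1 := congrFun (jacobi_mlieBracket hX hY (SmoothField.smul hc hZ)) x
    rw [mlieBracket_smul_right' hc hZ, mlieBracket_smul_right' hc hZ,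
      mlieBracket_smul_right' hc hZ, mlieBracket_add_right
        (hmd (SmoothField.smul hYc hZ)) (hmd (SmoothField.smul hc (hY.mlieBracket hZ))),
      mlieBracket_smul_right' hYc hZ, mlieBracket_smul_right' hc (hY.mlieBracket hZ)] at h1
    have h2 := mlieBracket_add_right (V := Y) (hmd (SmoothField.smul hXc hZ))
      (hmd (SmoothField.smul hc (hX.mlieBracket hZ)))
    rw [mlieBracket_smul_right' hXc hZ, mlieBracket_smul_right' hc (hX.mlieBracket hZ)] at h2
    simp only [Pi.add_apply, Pi.smul_apply'] at h0 h1 h2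
    rw [h2, h0] at h1
    have h3 : (d% c x (mlieBracket I X Y x) - (d% (fun y ↦ d% c y (Y y)) x (X x)
        - d% (fun y ↦ d% c y (X y)) x (Y x))) • Z x = 0 := by
      linear_combination (norm := module) -h1
    exact sub_eq_zero.1 ((smul_eq_zero.1 h3).resolve_right hv)
  · push Not at hv
    rw [hv (mlieBracket I X Y x), hv (X x), hv (Y x)]
    simp

variable (g : ContMDiffRiemannianMetric I ∞ E (fun x : M ↦ TangentSpace I x))

omit [FiniteDimensional ℝ E] in
lemma SmoothField.mdiffAt {X : Π x : M, TangentSpace I x} (hX : SmoothField X) (x : M) :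
    MDiffAt (T% X) x := (hX x).mdifferentiableAt (by simp)

lemma nabla_sub_nabla {X Y : Π x : M, TangentSpace I x} (hX : SmoothField X)
    (hY : SmoothField Y) : nabla g X Y - nabla g Y X = mlieBracket I X Y := by
  ext x
  exact leviCivita_torsion_free g (hX.mdiffAt x) (hY.mdiffAt x)

lemma nabla_add_right {X Y Y' : Π x : M, TangentSpace I x} (hY : SmoothField Y)
    (hY' : SmoothField Y') : nabla g X (Y + Y') = nabla g X Y + nabla g X Y' := by
  ext x
  have := (leviCivita g).isCovariantDerivativeOnUniv.add (hY.mdiffAt x) (hY'.mdiffAt x)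
  exact congrArg (fun A : TangentSpace I x →L[ℝ] TangentSpace I x ↦ A (X x)) this

lemma nabla_smul_right (a : ℝ) {X Y : Π x : M, TangentSpace I x} (hY : SmoothField Y) :
    nabla g X (a • Y) = a • nabla g X Y := by
  ext x
  have := (leviCivita g).isCovariantDerivativeOnUniv.smul_const (a := a) (hY.mdiffAt x)
  exact congrArg (fun A : TangentSpace I x →L[ℝ] TangentSpace I x ↦ A (X x)) this

/-- The Levi-Civita connection, acting on the smooth vector fields. -/
noncomputable def leviCivitaData [T2Space M] : LeviCivitaData (SmoothFields I M) (SmoothFunctions I M) where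
  met := LinearMap.mk₂ ℝ
    (fun X Y ↦ ⟨fun x ↦ g.inner x (X x) (Y x), fun x ↦
      contMDiffAt_metric g (X.contMDiff x) (Y.contMDiff x)⟩)
    (fun X X' Y ↦ by ext x; simp; rfl) (fun a X Y ↦ by ext x; simp; rfl)
    (fun X Y Y' ↦ by ext x; simp; rfl) (fun a X Y ↦ by ext x; simp; rfl)
  der X :=
    { toFun c := ⟨fun x ↦ d% c x (X x), contMDiff_mvfderiv_apply c.contMDiff X.contMDiff⟩
      map_add' c c' := by
        ext x
        have := mvfderiv_add ((c.contMDiff x).mdifferentiableAt (by simp))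
          ((c'.contMDiff x).mdifferentiableAt (by simp))
        exact congrArg (fun A : TangentSpace I x →L[ℝ] ℝ ↦ A (X x)) this
      map_smul' a c := by
        ext x
        change d% (fun y ↦ a * c y) x (X x) = a * d% c x (X x)
        rw [mvfderiv_fun_mul mdifferentiableAt_const ((c.contMDiff x).mdifferentiableAt (by simp)),
          mvfderiv_const]
        simp }
  con := LinearMap.mk₂ ℝ
    (fun X Y ↦ ⟨nabla g X Y, SmoothField.nabla g X.contMDiff Y.contMDiff⟩)
    (fun X X' Y ↦ by ext x; exact map_add (leviCivita g Y x) (X x) (X' x)) (fun a X Y ↦ by ext x; exact map_smul (leviCivita g Y x) a (X x))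
    (fun X Y Y' ↦ by
      ext x; exact congrFun (nabla_add_right g Y.contMDiff Y'.contMDiff) x)
    (fun a X Y ↦ by ext x; exact congrFun (nabla_smul_right g a Y.contMDiff) x)
  symm X Y := by ext x; exact g.symm x _ _
  nondegenerate X hX := by
    ext x
    by_contra hne
    exact (g.pos x _ hne).ne' (congrArg (fun c : SmoothFunctions I M ↦ c x) hX)
  compat X Y Z := by
    ext x
    exact leviCivita_metric g (X.mdifferentiableAt) (Y.mdifferentiableAt) (Z.mdifferentiableAt)
  der_bracket X Y c := by
    ext x
    have h := mvfderiv_mlieBracket c.contMDiff X.contMDiff Y.contMDiff x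
    rw [← nabla_sub_nabla g X.contMDiff Y.contMDiff] at h
    exact h
  jacobi X Y Z := by
    have hXY := nabla_sub_nabla g X.contMDiff Y.contMDiff
    have hXZ := nabla_sub_nabla g X.contMDiff Z.contMDiff
    have hYZ := nabla_sub_nabla g Y.contMDiff Z.contMDiff
    have h := jacobi_mlieBracket X.contMDiff Y.contMDiff Z.contMDiff
    rw [← nabla_sub_nabla g X.contMDiff (SmoothField.mlieBracket Y.contMDiff Z.contMDiff),
      ← nabla_sub_nabla g Y.contMDiff (SmoothField.mlieBracket X.contMDiff Z.contMDiff),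
      ← nabla_sub_nabla g (SmoothField.mlieBracket X.contMDiff Y.contMDiff) Z.contMDiff,
      ← hXY, ← hXZ, ← hYZ] at h
    ext x
    exact congrFun h x

end WeakNearlyC

/-! ### Weak nearly `C`-structures on a manifold as algebraic data. -/

noncomputable section

namespace WeakNearlyC

variable {E : Type*} [NormedAddCommGroup E] [NormedSpace ℝ E]
  {H : Type*} [TopologicalSpace H] {I : ModelWithCorners ℝ E H}
  {M : Type*} [TopologicalSpace M] [ChartedSpace H M] [IsManifold I ∞ M]

/-- A smooth `(1,1)`-tensor field, acting on the smooth vector fields. -/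
def SmoothEndField.toEnd {T : EndField I M} (hT : SmoothEndField T) :
    Module.End ℝ (SmoothFields I M) where
  toFun X := ⟨T.app X, SmoothField.app hT X.contMDiff⟩
  map_add' X Y := by ext x; exact map_add (T x) (X x) (Y x)
  map_smul' a X := by ext x; exact map_smul (T x) a (X x)

variable [FiniteDimensional ℝ E] {g : ContMDiffRiemannianMetric I ∞ E (fun x : M ↦ TangentSpace I x)}

namespace IsWeakMetricFStructure

variable {n s : ℕ} {f Q : EndField I M} {ξ : Fin s → Π x : M, TangentSpace I x}
  {η : Fin s → Π x : M, TangentSpace I x →L[ℝ] ℝ} (h : IsWeakMetricFStructure g n s f Q ξ η)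

include h

omit [FiniteDimensional ℝ E] in
-- The squared length of f ξ is 1 - 1 = 0 by `metric_f`.
lemma f_ξ (x : M) (i : Fin s) : f x (ξ i x) = 0 := by
  have h1 := h.metric_f x (ξ i x) (ξ i x)
  by_contra hne
  refine (g.pos x _ hne).ne' ?_
  rw [h1]
  simp [h.Q_ξ, h.orthonormal_ξ, h.η_ξ]

omit [FiniteDimensional ℝ E] in
lemma η_eq (x : M) (i : Fin s) (v : TangentSpace I x) : η i x v = g.inner x v (ξ i x) := by
  have h1 := h.metric_f x v (ξ i x)
  rw [h.f_ξ, map_zero, h.Q_ξ] at h1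
  simp only [h.η_ξ, mul_ite, mul_one, mul_zero, Finset.sum_ite_eq', Finset.mem_univ, if_true] at h1
  exact (sub_eq_zero.1 h1.symm).symm

omit [FiniteDimensional ℝ E] in
lemma η_f (x : M) (i : Fin s) (v : TangentSpace I x) : η i x (f x v) = 0 := by
  rw [h.η_eq, h.skew_f, h.f_ξ, map_zero, neg_zero]

/-- The projection onto the characteristic distribution, acting on the smooth fields. -/
def proj : Module.End ℝ (SmoothFields I M) :=
  h.smooth_f.toEnd * h.smooth_f.toEnd + h.smooth_Q.toEnd

omit [FiniteDimensional ℝ E] in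
-- Taking f² + Q as the definition of `proj` makes smoothness automatic; the usual formula is
-- recovered here.
lemma proj_apply (X : SmoothFields I M) (x : M) : h.proj X x = ∑ i, η i x (X x) • ξ i x := by
  have : h.proj X x = f x (f x (X x)) + Q x (X x) := rfl
  rw [this, h.f_sq]
  abel

omit [FiniteDimensional ℝ E] in
lemma η_proj (X : SmoothFields I M) (x : M) (i : Fin s) : η i x (h.proj X x) = η i x (X x) := by
  simp [h.proj_apply, h.η_ξ]

omit [FiniteDimensional ℝ E] in
lemma inContact_iff (X : SmoothFields I M) : InContact η X ↔ h.proj X = 0 := by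
  refine ⟨fun hX ↦ ?_, fun hX x i ↦ ?_⟩
  · ext x
    rw [h.proj_apply]
    exact Finset.sum_eq_zero fun i _ ↦ by rw [hX x i, zero_smul]
  · rw [← h.η_proj, hX]
    exact map_zero _

/-- The vector fields `ξ i`, as smooth vector fields. -/
def charField (i : Fin s) : SmoothFields I M := ⟨ξ i, h.smooth_ξ i⟩

end IsWeakMetricFStructure

variable [T2Space M]

lemma IsWeakNearlyC.data {n s : ℕ} {f Q : EndField I M} {ξ : Fin s → Π x : M, TangentSpace I x}
    {η : Fin s → Π x : M, TangentSpace I x →L[ℝ] ℝ} (h : IsWeakNearlyC g n s f Q ξ η) :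
    WeakNearlyCData (leviCivitaData g) h.smooth_f.toEnd h.smooth_Q.toEnd h.proj h.charField where
  skew X Y := by ext x; exact h.skew_f x _ _
  nearly X Y := by
    rw [← add_eq_zero_iff_eq_neg]
    ext x
    exact congrFun (h.nearly X Y X.contMDiff Y.contMDiff) x
  Q_symm X Y := by ext x; exact h.selfAdjoint_Q x _ _
  Q_inj X hX := by
    ext x
    refine (h.nonsingular_Q x).1 ?_
    have : Q x (X x) = 0 := congrArg (fun Y : SmoothFields I M ↦ Y x) hX
    rw [this]
    exact (map_zero _).symm
  sq := by simp [IsWeakMetricFStructure.proj]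
  F_P := by
    ext X x
    change f x (h.proj X x) = 0
    simp [h.proj_apply, h.f_ξ]
  P_F := by
    ext X x
    change h.proj (h.smooth_f.toEnd X) x = 0
    rw [h.proj_apply]
    exact Finset.sum_eq_zero fun i _ ↦ by
      rw [show h.smooth_f.toEnd X x = f x (X x) from rfl, h.η_f, zero_smul]
  P_P := by
    ext X x
    change h.proj (h.proj X) x = h.proj X x
    exact (h.proj_apply _ x).trans <| (Finset.sum_congr rfl fun i _ ↦ by rw [h.η_proj]).trans
      (h.proj_apply X x).symm
  Q_P := by
    ext X x
    change Q x (h.proj X x) = h.proj X x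
    simp [h.proj_apply, h.Q_ξ]
  P_symm X Y := by
    ext x
    change g.inner x (h.proj X x) (Y x) = g.inner x (X x) (h.proj Y x)
    simp [h.proj_apply, h.η_eq, g.symm x (ξ _ x) (Y x), mul_comm]
  P_ξ i := by
    ext x
    rw [h.proj_apply]
    change ∑ j, η j x (ξ i x) • ξ j x = ξ i x
    simp [h.η_ξ]
  P_eq_zero X := by
    rw [← h.inContact_iff]
    refine ⟨fun hX i ↦ ?_, fun hX x i ↦ ?_⟩
    · ext x
      exact (h.η_eq x i _).symm.trans (hX x i)
    · rw [h.η_eq]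
      exact congrArg (fun c : SmoothFunctions I M ↦ c x) (hX i)
  orthonormal X i j := by
    ext x
    change d% (fun y ↦ g.inner y (ξ i y) (ξ j y)) x (X x) = 0
    simp only [h.orthonormal_ξ, mvfderiv_const]
    rfl

lemma curvature_eq (X Y Z : SmoothFields I M) :
    curvature g X Y Z = (leviCivitaData g).curv X Y Z := by
  rw [curvature, ← nabla_sub_nabla g X.contMDiff Y.contMDiff]
  rfl

lemma curvature_apply (X Y Z : SmoothFields I M) (x : M) :
    curvature g X Y Z x = (leviCivitaData g).curv X Y Z x :=
  congrFun (curvature_eq X Y Z) x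

/-- In the commuting case, the curvature operators `R_{ξ j, ξ k}` vanish. -/
lemma IsWeakNearlyC.curv_charField {n s : ℕ} {f Q : EndField I M}
    {ξ : Fin s → Π x : M, TangentSpace I x}
    {η : Fin s → Π x : M, TangentSpace I x →L[ℝ] ℝ} (h : IsWeakNearlyC g n s f Q ξ η)
    (hQ : ∀ X, (leviCivitaData g).dEnd h.smooth_Q.toEnd X = 0)
    (comm : ∀ i j, mlieBracket I (ξ i) (ξ j) = 0) (j k : Fin s) :
    (leviCivitaData g).curv (h.charField j) (h.charField k) = 0 := by
  have comm' : ∀ i j, (leviCivitaData g).con (h.charField i) (h.charField j)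
      = (leviCivitaData g).con (h.charField j) (h.charField i) := fun i j ↦ by
    rw [← sub_eq_zero]
    ext x
    have := nabla_sub_nabla g (h.smooth_ξ i) (h.smooth_ξ j)
    rw [comm] at this
    exact congrFun this x
  -- The derivative of f along ξ i acts on each tangent space as f ∘ ∇ξ i, so the finite-dimensional
  -- trace argument applies pointwise.
  let φ : Fin s → (x : M) → Module.End ℝ (TangentSpace I x) := fun i x ↦
    (f x).toLinearMap.comp (leviCivita g (ξ i) x).toLinearMap
  have hφ : ∀ i X x, (leviCivitaData g).dEnd h.smooth_f.toEnd (h.charField i) X x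
      = φ i x (X x) := fun i X x ↦ by
    rw [h.data.dEnd_ξ_apply]; rfl
  rw [h.data.curv_eq_bracket hQ comm']
  ext X x
  have hd := h.data.double_bracket hQ comm' j k
  have skew : ∀ i v w, g.inner x (φ i x v) w = -g.inner x v (φ i x w) := fun i v w ↦ by
    obtain ⟨V, rfl⟩ := exists_smooth_extension v
    obtain ⟨W, rfl⟩ := exists_smooth_extension w
    rw [← hφ, ← hφ]
    exact congrArg (fun c : SmoothFunctions I M ↦ c x)
      ((leviCivitaData g).dEnd_skew h.data.skew (h.charField i) V W)
  have hc := LinearMap.commutator_eq_zero_of_skew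
    (B := (ContinuousLinearMap.coeLM ℝ).comp (g.inner x).toLinearMap) (a := φ j x) (b := φ k x)
    ⟨fun v w ↦ g.symm x v w⟩ (fun v hv ↦ g.pos x v hv) (skew j) (skew k) (by
      ext v
      obtain ⟨V, rfl⟩ := exists_smooth_extension v
      have := congrArg (fun A : Module.End ℝ (SmoothFields I M) ↦ A V x) hd
      simpa [hφ] using this)
  have := congrArg (fun A : Module.End ℝ (TangentSpace I x) ↦ A (X x)) hc
  simp only [LinearMap.sub_apply, Module.End.mul_apply, LinearMap.zero_apply] at this
  simp [hφ, this]

end WeakNearlyC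

end

/-! ### The main theorem. -/

open WeakNearlyC in
theorem mainTheorem7
    {E : Type*} [NormedAddCommGroup E] [NormedSpace ℝ E] [FiniteDimensional ℝ E]
    {M : Type*} [TopologicalSpace M] [T2Space M]
    [ChartedSpace E M] [IsManifold 𝓘(ℝ, E) ∞ M]
    (g : ContMDiffRiemannianMetric 𝓘(ℝ, E) ∞ E (fun x : M ↦ TangentSpace 𝓘(ℝ, E) x))
    (n s : ℕ) (f Q : EndField 𝓘(ℝ, E) M)
    (ξ : Fin s → Π x : M, TangentSpace 𝓘(ℝ, E) x)
    (η : Fin s → Π x : M, TangentSpace 𝓘(ℝ, E) x →L[ℝ] ℝ)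
    (h : IsWeakNearlyC g n s f Q ξ η) :
    (∀ X Y Z V : Π x : M, TangentSpace 𝓘(ℝ, E) x,
      SmoothField X → SmoothField Y → SmoothField Z → SmoothField V → ∀ x : M,
        g.inner x (curvature g (f.app X) Y Z x) (V x)
          + g.inner x (curvature g X (f.app Y) Z x) (V x)
          + g.inner x (curvature g X Y (f.app Z) x) (V x)
          + g.inner x (curvature g X Y Z x) (f.app V x) = 0) ∧
    (QParallelOnContact g Q η → QCurvatureInvariant g Q η →
      (∀ j, ∀ X Y Z : Π x : M, TangentSpace 𝓘(ℝ, E) x,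
        SmoothField X → SmoothField Y → SmoothField Z → InContact η Z → ∀ x : M,
          g.inner x (curvature g (ξ j) Z (f.app X) x) (f.app Y x) = 0) ∧
      ContactCurvatureInvariant g η ∧
      ((∀ i j, mlieBracket 𝓘(ℝ, E) (ξ i) (ξ j) = 0) →
        (∀ j k, ∀ Z : Π x : M, TangentSpace 𝓘(ℝ, E) x, SmoothField Z →
          curvature g (ξ j) (ξ k) Z = 0) ∧
        (∀ j, ∀ X Y Z : Π x : M, TangentSpace 𝓘(ℝ, E) x,
          SmoothField X → SmoothField Y → SmoothField Z → ∀ x : M,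
            g.inner x (curvature g (ξ j) Z (f.app X) x) (f.app Y x) = 0))) := by
  set L := leviCivitaData g
  set F := h.smooth_f.toEnd
  have hd := h.data
  have curv_eq := fun X Y Z : SmoothFields 𝓘(ℝ, E) M ↦ curvature_apply (g := g) X Y Z
  refine ⟨fun X Y Z V hX hY hZ hV x ↦ ?_, fun hQ hC ↦ ?_⟩
  · have := congrArg (fun c : SmoothFunctions 𝓘(ℝ, E) M ↦ c x)
      (LeviCivitaData.curv_derivation hd.skew hd.nearly ⟨X, hX⟩ ⟨Y, hY⟩ ⟨Z, hZ⟩ ⟨V, hV⟩)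
    have e1 := curv_eq (F ⟨X, hX⟩) ⟨Y, hY⟩ ⟨Z, hZ⟩ x
    have e2 := curv_eq ⟨X, hX⟩ (F ⟨Y, hY⟩) ⟨Z, hZ⟩ x
    have e3 := curv_eq ⟨X, hX⟩ ⟨Y, hY⟩ (F ⟨Z, hZ⟩) x
    have e4 := curv_eq ⟨X, hX⟩ ⟨Y, hY⟩ ⟨Z, hZ⟩ x
    erw [e1, e2, e3, e4]
    exact this
  have hQ' := hd.Q_parallel fun X Y hY ↦ by
    ext x
    exact congrFun (hQ X Y X.contMDiff Y.contMDiff ((h.inContact_iff Y).2 hY)) x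
  have inv : ∀ X Y Z : SmoothFields 𝓘(ℝ, E) M, h.proj X = 0 → h.proj Y = 0 → h.proj Z = 0 →
      h.proj (L.curv X Y Z) = 0 := fun X Y Z hX hY hZ ↦ by
    refine hd.curv_contact (fun X Y Z hX hY hZ ↦ ?_) hX hY hZ
    rw [← h.inContact_iff] at hX hY hZ ⊢
    have := hC X Y Z X.contMDiff Y.contMDiff Z.contMDiff hX hY hZ
    rw [← curvature_eq]
    exact this
  -- F X and F Y always lie in the contact distribution, so curvature invariance applies once ξ j is
  -- moved to the last slot.
  have key : ∀ j, ∀ X Y Z : SmoothFields 𝓘(ℝ, E) M, h.proj Z = 0 →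
      L.met (L.curv (F X) (F Y) (h.charField j)) Z = 0 := fun j X Y Z hZ ↦ by
    rw [L.met_curv_skew, (hd.P_eq_zero _).1 (inv _ _ _ (hd.P_F_apply X) (hd.P_F_apply Y) hZ) j,
      neg_zero]
  have part1 : ∀ j, ∀ X Y Z : SmoothFields 𝓘(ℝ, E) M, h.proj Z = 0 →
      L.met (L.curv (h.charField j) Z (F X)) (F Y) = 0 := fun j X Y Z hZ ↦ by
    rw [L.pair_symm, key j X Y Z hZ]
  have concrete : ∀ j, ∀ X Y Z : SmoothFields 𝓘(ℝ, E) M, ∀ x,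
      g.inner x (curvature g (ξ j) Z (f.app X) x) (f.app Y x)
        = L.met (L.curv (h.charField j) Z (F X)) (F Y) x := fun j X Y Z x ↦ by
    have := curv_eq (h.charField j) Z (F X) x
    erw [this]
    rfl
  refine ⟨fun j X Y Z hX hY hZ hZD x ↦ ?_, fun X Y Z hX hY hZ hXD hYD hZD ↦ ?_, fun comm ↦ ?_⟩
  · refine (concrete j ⟨X, hX⟩ ⟨Y, hY⟩ ⟨Z, hZ⟩ x).trans ?_
    rw [part1 j _ _ _ ((h.inContact_iff ⟨Z, hZ⟩).1 hZD)]
    rfl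
  · have e := curvature_eq (g := g) ⟨X, hX⟩ ⟨Y, hY⟩ ⟨Z, hZ⟩
    change curvature g X Y Z = _ at e
    rw [e, h.inContact_iff]
    exact inv _ _ _ ((h.inContact_iff ⟨X, hX⟩).1 hXD) ((h.inContact_iff ⟨Y, hY⟩).1 hYD)
      ((h.inContact_iff ⟨Z, hZ⟩).1 hZD)
  have R0 := h.curv_charField hQ' comm
  refine ⟨fun j k Z hZ ↦ ?_, fun j X Y Z hX hY hZ x ↦ ?_⟩
  · have := curvature_eq (g := g) (h.charField j) (h.charField k) ⟨Z, hZ⟩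
    rw [R0] at this
    exact this
  · refine (concrete j ⟨X, hX⟩ ⟨Y, hY⟩ ⟨Z, hZ⟩ x).trans ?_
    rw [L.pair_symm]
    set U := L.curv (F ⟨X, hX⟩) (F ⟨Y, hY⟩) (h.charField j)
    -- Split Z into its characteristic and contact parts: the vanishing of R_{ξ j, ξ i} disposes of
    -- the former, `key` of the latter.
    have hU : ∀ i, L.met U (h.charField i) = 0 := fun i ↦ by
      rw [← L.pair_symm, R0]; simp
    -- The model is only ℝ-linear, so the function coefficients of the projection are handled at the
    -- point x.
    have hPZ : L.met U (h.proj ⟨Z, hZ⟩) x = 0 := by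
      change g.inner x (U x) (h.proj ⟨Z, hZ⟩ x) = 0
      rw [h.proj_apply, map_sum]
      refine Finset.sum_eq_zero fun i _ ↦ ?_
      have : g.inner x (U x) (ξ i x) = 0 :=
        congrArg (fun c : SmoothFunctions 𝓘(ℝ, E) M ↦ c x) (hU i)
      rw [map_smul, this, smul_zero]
    have hD := key j ⟨X, hX⟩ ⟨Y, hY⟩ (⟨Z, hZ⟩ - h.proj ⟨Z, hZ⟩) (by
      rw [map_sub, ← Module.End.mul_apply, hd.P_P, sub_self])
    rw [map_sub, sub_eq_zero] at hD
    rw [hD, hPZ]
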